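/- Let $d\ge 2$, $k\ge 1$ and write $\mathrm{e}(t)=e^{2\pi i t}$. Let $G=\mathrm{SL}(2,\mathbb R)\ltimes\mathbb R^{2d}$ with multiplication $(M,\xi)(M',\xi')=(MM',\xi+M\xi')$, where for $M=\begin{pmatrix}a&b\\c&e\end{pmatrix}$ and $\xi=\begin{pmatrix}x\\y\end{pmatrix}$, $x,y\in\mathbb R^d$, $M\xi=\begin{pmatrix}ax+by\\cx+ey\end{pmatrix}$. Using the Iwasawa decomposition $M=\begin{pmatrix}1&u\\0&1\end{pmatrix}\begin{pmatrix}v^{1/2}&0\\0&v^{-1/2}\end{pmatrix}\begin{pmatrix}\cos\phi&-\sin\phi\\\sin\phi&\cos\phi\end{pmatrix}$ with $u\in\mathbb R$, $v>0$, $\phi\in[0,2\pi)$, write $(M,\xi)=(u+iv,\phi,\xi)$. *Theta functions.* For a function $f(Y,Y')$ of Schwartz class on $\mathbb R^{d\times k}\times\mathbb R^{d\times k}$ and $\phi=(\phi_1,\dots,\phi_k)$, let $f_\phi$ be obtained from $f$ by applying in each pair of columns $(y_j,y_j')$ the following transform: the identity if $\phi_j=0\bmod 2\pi$, the reflection $(y_j,y'_j)\mapsto(-y_j,-y'_j)$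 if $\phi_j=\pi\bmod 2\pi$, and otherwise integration against the kernel $$|\sin\phi_j|^{-d}\,\mathrm e\!\left(\frac{\frac12(\|y_j\|^2+\|z_j\|^2-\|y_j'\|^2-\|z_j'\|^2)\cos\phi_j-y_j\cdot z_j+y_j'\cdot z_j'}{\sin\phi_j}\right)$$ in the variables $(z_j,z_j')\in\mathbb R^d\times\mathbb R^d$. For $g=(g_1,\dots,g_k)\in G^k$ with $g_j=\left(u_j+iv_j,\phi_j,\begin{pmatrix}x_j\\y_j\end{pmatrix}\right)$ put $$\Theta^{(k)}_f(g)=\sum_{m_1,\dots,m_k,m_1',\dots,m_k'\in\mathbb Z^d} f_\phi\big((v_j^{1/2}(m_j-y_j))_j,(v_j^{1/2}(m_j'-y_j))_j\big)\prod_{j=1}^k v_j^{d/2}\,\mathrm e\big(\tfrac12u_j(\|m_j-y_j\|^2-\|m_j'-y_j\|^2)+x_j\cdot(m_j-m_j')\big).$$ *Test functions.* Let $\tilde{\mathcal S}_k$ be the class of continuous functions $f(Y,Y',u,\eta,\omega)$, complex valued on $\mathbb R^{d\times k}\times\mathbb R^{d\times k}\times\mathbb R^k\times\mathbb R^d\times\mathbb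 R$, all of whose partial derivatives $\partial_Y^{\beta_1}\partial_{Y'}^{\beta_2}f$ exist, are continuous in all variables, and satisfy $$\sup(1+\|Y\|)^T(1+\|Y'\|)^T(1+\|u\|)^T(1+\|\eta\|)^T(1+|\omega|)^T\,|\partial_Y^{\beta_1}\partial_{Y'}^{\beta_2}f|<\infty\quad\text{for every } T>1.$$ For $f\in\tilde{\mathcal S}_k$, $\beta>0$, $r>0$, $g\in G^k$ and $u\in\mathbb R^k$ set $$F_r^{k,\beta}(g,u)=\int_{\mathbb R}\left|\int_{\mathbb R^d}\Theta^{(k)}_{f(\cdot,\cdot,u,\eta,\omega)}\big(g\,z_k(r^d\eta)\big)\,d\eta\right|^\beta d\omega,\qquad z_k(\eta)=\left(\Big(1,\begin{pmatrix}0\\\frac12\eta\end{pmatrix}\Big),\dots,\Big(1,\begin{pmatrix}0\\\frac12\eta\end{pmatrix}\Big)\right)\in G^k.$$ *Diophantine condition.* A vector $\alpha\in\mathbb R^d$ is Diophantine of type $\kappa\in\mathbb R$ if there is $C>0$ with $\max_j|\alpha_j-m_j/q|>C/q^\kappa$ for all $m_1,\dots,m_d,q\in\mathbb Z$, $q>0$.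 **Proposition.** Let $f\in\tilde{\mathcal S}_k$ and $0<\beta<1$. Let $Y=(y_1,\dots,y_k)\in\mathbb R^{d\times k}$ be such that every $y_j$ is Diophantine of type $\kappa$, where $\kappa<\frac{d-1}{d-2}$ (no restriction on $\kappa$ if $d=2$), and such that for every $j$ the components of $(1,y_j)$ are linearly independent over $\mathbb Q$. Let $w:\mathbb R^k\to\mathbb R$ be measurable and bounded with compact support. For $r>0$ and $u\in\mathbb R^k$ denote by $g_r(u)\in G^k$ the point with components $\left(u_j+ir^2,0,\begin{pmatrix}0\\y_j\end{pmatrix}\right)$. Then, for every $r>0$, the series and integrals defining $F_r^{k,\beta}(g_r(u),r^{d-2}u)$ converge absolutely for every $u\in\mathbb R^k$, the function $u\mapsto F_r^{k,\beta}(g_r(u),r^{d-2}u)\,w(r^{d-2}u)$ is integrable on $\mathbb R^k$, and $$\limsup_{r\to0^+}\left|\,r^{k(d-2)}\int_{\mathbb R^k}F_r^{k,\beta}\big(g_r(u),r^{d-2}u\big)\,w(r^{d-2}u)\,du\,\right|<\infty.$$ -/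

import Mathlib

open MeasureTheory Filter Topology

noncomputable section

/-- `ℝ^d` with the Euclidean norm. -/
abbrev RVec (d : ℕ) : Type := EuclideanSpace ℝ (Fin d)

/-- `ℝ^{d × k}`, a matrix being given by its `k` columns in `ℝ^d`. -/
abbrev RMat (d k : ℕ) : Type := Fin k → RVec d

/-- `e(t) = exp(2πit)`. -/
def expTwoPiI (t : ℝ) : ℂ := Complex.exp (2 * (Real.pi : ℂ) * Complex.I * (t : ℂ))

/-- The inclusion of `ℤ^d` in `ℝ^d`. -/
def intVec {d : ℕ} (m : Fin d → ℤ) : RVec d := WithLp.toLp 2 (fun i => (m i : ℝ))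

/-- `α ∈ ℝ^d` is Diophantine of type `κ`: for some `C > 0`,
`max_j |α_j - m_j / q| > C / q^κ` for all integers `m_1, …, m_d, q` with `q > 0`. -/
def IsDiophantineVec {d : ℕ} (κ : ℝ) (α : RVec d) : Prop :=
  ∃ C : ℝ, 0 < C ∧ ∀ (m : Fin d → ℤ) (q : ℤ), 0 < q →
    ∃ j : Fin d, C / (q : ℝ) ^ κ < |α j - (m j : ℝ) / (q : ℝ)|

/-- The components of `(1, y)` are linearly independent over `ℚ`. -/
def OneLinIndepRat {d : ℕ} (y : RVec d) : Prop :=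
  LinearIndependent ℚ (Fin.cons (1 : ℝ) (fun i : Fin d => y i) : Fin (d + 1) → ℝ)

/-! ### The group `G = SL(2,ℝ) ⋉ ℝ^{2d}` -/

/-- Elements `(M, ξ)` with `ξ = (x, y) ∈ ℝ^d × ℝ^d`. -/
@[ext]
structure ThetaGroup (d : ℕ) : Type where
  lin : Matrix.SpecialLinearGroup (Fin 2) ℝ
  x : RVec d
  y : RVec d

/-- `(M, ξ)(M', ξ') = (M M', ξ + M ξ')`. -/
instance (d : ℕ) : Mul (ThetaGroup d) where
  mul g h :=
    { lin := g.lin * h.lin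
      x := g.x + (g.lin.1 0 0 • h.x + g.lin.1 0 1 • h.y)
      y := g.y + (g.lin.1 1 0 • h.x + g.lin.1 1 1 • h.y) }

/-- `n_-(u)`. -/
def nMinus (u : ℝ) : Matrix.SpecialLinearGroup (Fin 2) ℝ :=
  ⟨!![1, u; 0, 1], by simp [Matrix.det_fin_two]⟩

/-- `Φ^t = diag(e^{-t/2}, e^{t/2})`. -/
def geodesicDiag (t : ℝ) : Matrix.SpecialLinearGroup (Fin 2) ℝ :=
  ⟨!![Real.exp (-t / 2), 0; 0, Real.exp (t / 2)], by
    rw [Matrix.det_fin_two_of, ← Real.exp_add, mul_zero, sub_zero, ← Real.exp_zero]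
    congr 1; ring⟩

/-- The rotation `R(φ)`. -/
def rotSL (φ : ℝ) : Matrix.SpecialLinearGroup (Fin 2) ℝ :=
  ⟨!![Real.cos φ, -Real.sin φ; Real.sin φ, Real.cos φ], by
    rw [Matrix.det_fin_two_of]; nlinarith [Real.sin_sq_add_cos_sq φ]⟩

/-- The element `(u + iv, φ, (x, y))` of `G` (for `v > 0`), through the Iwasawa decomposition
`M = n_-(u) Φ^{-log v} R(φ)`. -/
def ofIwasawa {d : ℕ} (u v φ : ℝ) (x y : RVec d) : ThetaGroup d where
  lin := nMinus u * geodesicDiag (-Real.log v) * rotSL φ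
  x := x
  y := y

/-- The coordinate `τ = u + iv` of `M = n_-(u) Φ^{-log v} R(φ)`, namely `τ = M · i`. -/
def iwasawaTau (M : Matrix.SpecialLinearGroup (Fin 2) ℝ) : UpperHalfPlane :=
  M • UpperHalfPlane.I

/-- The coordinate `φ ∈ [0, 2π)` of `M = n_-(u) Φ^{-log v} R(φ)`: the lower row of `M` is
`v^{-1/2} (sin φ, cos φ)`. -/
def iwasawaPhi (M : Matrix.SpecialLinearGroup (Fin 2) ℝ) : ℝ :=
  toIcoMod Real.two_pi_pos 0 (Complex.arg ⟨M.1 1 1, M.1 1 0⟩)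

/-! ### The transform `f ↦ f_φ` -/

/-- The kernel `G_φ(y, y', z, z')` on `(ℝ^d)^4`, for `sin φ ≠ 0`. -/
def rotKernel {d : ℕ} (φ : ℝ) (y y' z z' : RVec d) : ℂ :=
  ((|Real.sin φ| ^ d)⁻¹ : ℝ) *
    expTwoPiI (((1 / 2) * (‖y‖ ^ 2 + ‖z‖ ^ 2 - ‖y'‖ ^ 2 - ‖z'‖ ^ 2) * Real.cos φ
      - inner ℝ y z + inner ℝ y' z') / Real.sin φ)

/-- The columns `z_j` where `φ_j ≠ 0 mod π`; the column `y_j` where `φ_j = 0 mod 2π` and `-y_j`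
where `φ_j = π mod 2π` (`cos φ_j` is `1` and `-1` there). -/
def mixColumns {d k : ℕ} (φ : Fin k → ℝ) (Y : RMat d k)
    (Z : {j : Fin k // Real.sin (φ j) ≠ 0} → RVec d) : RMat d k :=
  fun j => if h : Real.sin (φ j) ≠ 0 then Z ⟨j, h⟩ else Real.cos (φ j) • Y j

/-- `f_φ` for `φ = (φ_1, …, φ_k)`: the integral transform with kernel `∏_j G_{φ_j}` in the
columns with `φ_j ≠ 0 mod π`, the identity or the reflection in the other columns.
If no `φ_j` is `0 mod π`, this is the integral over all of `ℝ^{d×k} × ℝ^{d×k}`; if all of them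
are, the integral is over a point. -/
def rotTransform {d k : ℕ} (f : RMat d k → RMat d k → ℂ) (φ : Fin k → ℝ)
    (Y Y' : RMat d k) : ℂ :=
  ∫ Z : ({j : Fin k // Real.sin (φ j) ≠ 0} → RVec d) ×
      ({j : Fin k // Real.sin (φ j) ≠ 0} → RVec d),
    (∏ j : {j : Fin k // Real.sin (φ j) ≠ 0},
      rotKernel (φ j) (Y j) (Y' j) (Z.1 j) (Z.2 j)) *
      f (mixColumns φ Y Z.1) (mixColumns φ Y' Z.2)

/-! ### Theta functions on `G^k` -/

/-- The summand of `Θ_f^{(k)}(g)` with index `(M, M') ∈ ℤ^{d×k} × ℤ^{d×k}`. -/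
def thetaTerm {d k : ℕ} (f : RMat d k → RMat d k → ℂ) (g : Fin k → ThetaGroup d)
    (M : (Fin k → Fin d → ℤ) × (Fin k → Fin d → ℤ)) : ℂ :=
  rotTransform f (fun j => iwasawaPhi (g j).lin)
      (fun j => Real.sqrt (iwasawaTau (g j).lin).im • (intVec (M.1 j) - (g j).y))
      (fun j => Real.sqrt (iwasawaTau (g j).lin).im • (intVec (M.2 j) - (g j).y)) *
    ∏ j : Fin k, ((((iwasawaTau (g j).lin).im ^ ((d : ℝ) / 2) : ℝ) : ℂ) *
      expTwoPiI ((1 / 2) * (iwasawaTau (g j).lin).re *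
          (‖intVec (M.1 j) - (g j).y‖ ^ 2 - ‖intVec (M.2 j) - (g j).y‖ ^ 2)
        + inner ℝ (g j).x (intVec (M.1 j) - intVec (M.2 j))))

/-- The theta function `Θ_f^{(k)}` on `G^k`. -/
def higherTheta {d k : ℕ} (f : RMat d k → RMat d k → ℂ) (g : Fin k → ThetaGroup d) : ℂ :=
  ∑' M : (Fin k → Fin d → ℤ) × (Fin k → Fin d → ℤ), thetaTerm f g M

/-- The class `S̃_k` of functions `f(Y, Y', u, η, ω)`: all derivatives in `(Y, Y')` exist, are
continuous in all variables and rapidly decaying. The partial derivatives of order `n` in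
`(Y, Y')` are the components of the `n`-th derivative of `f(·, ·, u, η, ω)`; the case `n = 0`
of `cont` is the continuity of `f`. -/
structure IsSchwartzTilde {d k : ℕ}
    (f : RMat d k → RMat d k → (Fin k → ℝ) → RVec d → ℝ → ℂ) : Prop where
  smooth : ∀ (u : Fin k → ℝ) (η : RVec d) (ω : ℝ),
    ContDiff ℝ ((⊤ : ℕ∞) : WithTop ℕ∞) (fun Y : RMat d k × RMat d k => f Y.1 Y.2 u η ω)
  cont : ∀ n : ℕ, Continuous
    (fun p : (RMat d k × RMat d k) × (Fin k → ℝ) × RVec d × ℝ =>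
      iteratedFDeriv ℝ n (fun Y : RMat d k × RMat d k => f Y.1 Y.2 p.2.1 p.2.2.1 p.2.2.2) p.1)
  decay : ∀ n T : ℕ, ∃ C : ℝ, ∀ (Y Y' : RMat d k) (u : Fin k → ℝ) (η : RVec d) (ω : ℝ),
    (1 + ‖Y‖) ^ T * (1 + ‖Y'‖) ^ T * (1 + ‖u‖) ^ T * (1 + ‖η‖) ^ T * (1 + |ω|) ^ T *
      ‖iteratedFDeriv ℝ n (fun V : RMat d k × RMat d k => f V.1 V.2 u η ω) (Y, Y')‖ ≤ C

/-- `z_k(η) ∈ G^k`, all of whose components are `(1, (0, η/2))`. -/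
def zShift {d : ℕ} (k : ℕ) (η : RVec d) : Fin k → ThetaGroup d :=
  fun _ => { lin := 1, x := 0, y := (1 / 2 : ℝ) • η }

/-- `F_r^{k,β}(g, u) = ∫_ℝ | ∫_{ℝ^d} Θ^{(k)}_{f(·, u, η, ω)}(g z_k(r^d η)) dη |^β dω`. -/
def higherF {d k : ℕ} (f : RMat d k → RMat d k → (Fin k → ℝ) → RVec d → ℝ → ℂ)
    (β r : ℝ) (g : Fin k → ThetaGroup d) (u : Fin k → ℝ) : ℝ :=
  ∫ ω : ℝ, ‖∫ η : RVec d,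
    higherTheta (fun Y Y' => f Y Y' u η ω) (g * zShift k (r ^ d • η))‖ ^ β

/-- The series and the integrals in the definition of `F_r^{k,β}(g, u)` converge absolutely. -/
def HigherFConverges {d k : ℕ} (f : RMat d k → RMat d k → (Fin k → ℝ) → RVec d → ℝ → ℂ)
    (β r : ℝ) (g : Fin k → ThetaGroup d) (u : Fin k → ℝ) : Prop :=
  (∀ (η : RVec d) (ω : ℝ),
    Summable (thetaTerm (fun Y Y' => f Y Y' u η ω) (g * zShift k (r ^ d • η)))) ∧
  (∀ ω : ℝ, Integrable (fun η : RVec d =>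
    higherTheta (fun Y Y' => f Y Y' u η ω) (g * zShift k (r ^ d • η)))) ∧
  Integrable (fun ω : ℝ => ‖∫ η : RVec d,
    higherTheta (fun Y Y' => f Y Y' u η ω) (g * zShift k (r ^ d • η))‖ ^ β)

/-- The point `(u + i r² I_k, 0, (0, Y)) ∈ G^k`. -/
def horoPoint {d k : ℕ} (r : ℝ) (Y : RMat d k) (u : Fin k → ℝ) : Fin k → ThetaGroup d :=
  fun j => ofIwasawa (u j) (r ^ 2) 0 0 (Y j)

end

open scoped ENNReal

/-! ### Sums over lattices -/

/-! At a point of the horocycle the rotation is trivial, and the shift by `zShift` only translates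
the argument of the test function: in the phase the terms linear in η cancel
(`thetaTerm_horoPoint`). Since |m-y|² - |m'-y|² = (m-m')·(m+m'-2y), the substitution m = b+c, m' =
-c makes the phase linear in c, with frequency u_j(b_ji - 2y_ji) in the coordinate (j,i). The sum
over c runs over a lattice of mesh r, and summation by parts gains arbitrary powers of 1 +
‖frequency‖/r (`DerivDecay.norm_oscSum_le`), where ‖·‖ is the distance to the nearest integer. About
r^(-dk) values of c matter, which absorbs the factor r^(dk). So theta is at most a product over
(j,i) of values of `shearSum`, uniformly in r ≤ 1. As β < 1, x^β ≤ 1 + x reduces everything to a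
first moment, and since the j-th factor depends on u_j alone, Tonelli reduces it to one variable u
and one vector y.

In one variable, `shearSum` is a weighted count of the points near the origin in a translate of the
unimodular lattice of all (rb, (ub-n)/r). Dirichlet's theorem gives a reduced fraction p/q, q ≤ 1/r,
such that (rq, (uq-p)/r) is a lattice vector of length l ≤ 1. Splitting the translate into lines
parallel to it bounds the count by a multiple of l⁻¹(1 + ‖2uqy‖/l)^(-A) (`shearSum_le_of_coprime`).
The product over the coordinates of y is O(l^(-d)(1 + ρ(p)/l)^(-d)), where ρ(p) = `doubleDist y p`
no longer involves u.

It remains to integrate over an interval of length of order r^(-(d-2)). The fraction with p = 0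
contributes a peak of that same mass. For p ≠ 0 the bound is at most ρ(p)^(-σ) l^(-(d-σ)). Integers
p with ρ(p) ≤ t are separated by a multiple of t^(-1/(κ-1)), because differences again have small ρ;
hence ρ(p)^(-σ) is bounded on average if σ < 1/(κ-1) (`exists_sum_rpow_neg_le`). The integral over u
and the sum over q are under control if d-2 < σ < d. For κ > 1 such a σ exists precisely when κ(d-2)
< d-1 (`lintegral_prod_shearSum_le`). -/

theorem ENNReal.tsum_pi_prod {ι : Type*} [Fintype ι] {α : Type*} (f : ι → α → ℝ≥0∞) :
    ∑' b : ι → α, ∏ i, f i (b i) = ∏ i, ∑' a, f i a := by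
  classical
  revert f
  refine Fintype.induction_empty_option (P := fun ι _ => ∀ f : ι → α → ℝ≥0∞,
    ∑' b : ι → α, ∏ i, f i (b i) = ∏ i, ∑' a, f i a) ?_ ?_ ?_ ι
  · intro κ ι _ e ih f
    let _ : Fintype κ := Fintype.ofEquiv ι e.symm
    rw [← Equiv.prod_comp e, ← ih (fun i => f (e i)),
      ← (Equiv.arrowCongr e (Equiv.refl α)).tsum_eq]
    refine tsum_congr fun b => ?_
    rw [← Equiv.prod_comp e]
    simp
  · intro f
    simp
  · intro κ _ ih f
    rw [← (Equiv.piOptionEquivProd (β := fun _ => α)).symm.tsum_eq, ENNReal.tsum_prod']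
    simp only [Fintype.prod_option, Equiv.piOptionEquivProd, Equiv.coe_fn_symm_mk]
    simp only [ENNReal.tsum_mul_left, ih, ENNReal.tsum_mul_right]

/-- Telescoping: (1+l(n+1))⁻² is at most l⁻¹ times the decrement of 1/(1+ln). The term n = 0
contributes 1 and each half line at most 1/l. -/
theorem tsum_int_abs_mul_le {l : ℝ} (hl : 0 < l) :
    ∑' n : ℤ, ENNReal.ofReal (((1 + l * |(n : ℝ)|) ^ 2)⁻¹) ≤ ENNReal.ofReal (1 + 2 / l) := by
  have key : ∑' n : ℕ, ENNReal.ofReal (((1 + l * ((n : ℝ) + 1)) ^ 2)⁻¹) ≤ ENNReal.ofReal (1 / l) := by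
    refine ENNReal.tsum_le_of_sum_range_le fun N => ?_
    rw [← ENNReal.ofReal_sum_of_nonneg (fun i _ => by positivity)]
    refine ENNReal.ofReal_le_ofReal ?_
    have : ∀ N : ℕ, ∑ i ∈ Finset.range N, ((1 + l * ((i : ℝ) + 1)) ^ 2)⁻¹
        ≤ 1 / l * (1 - 1 / (1 + l * N)) := by
      intro N
      induction N with
      | zero => simp
      | succ n ih =>
        rw [Finset.sum_range_succ]
        have h1 : (0 : ℝ) < 1 + l * n := by positivity
        have h2 : (0 : ℝ) < 1 + l * (n + 1) := by positivity
        have : ((1 + l * ((n : ℝ) + 1)) ^ 2)⁻¹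
            ≤ 1 / l * (1 / (1 + l * n) - 1 / (1 + l * (n + 1))) := by
          rw [div_sub_div _ _ h1.ne' h2.ne', div_mul_div_comm, inv_eq_one_div,
            div_le_div_iff₀ (by positivity) (by positivity)]
          nlinarith [mul_pos hl h1, mul_pos hl h2, mul_pos hl hl, mul_pos (mul_pos hl hl) h2]
        push_cast
        linarith
    refine (this N).trans ?_
    have : (0 : ℝ) ≤ 1 / (1 + l * N) := by positivity
    have h : (0 : ℝ) ≤ 1 / l := by positivity
    nlinarith
  rw [tsum_of_nat_of_neg_add_one ENNReal.summable ENNReal.summable]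
  rw [tsum_eq_zero_add' ENNReal.summable]
  have e1 : ∀ n : ℕ, |((-((n : ℤ) + 1) : ℤ) : ℝ)| = (n : ℝ) + 1 := by
    intro n; push_cast; rw [abs_neg, abs_of_nonneg (by positivity)]
  have e2 : ∀ n : ℕ, |(((n + 1 : ℕ) : ℤ) : ℝ)| = (n : ℝ) + 1 := by
    intro n; push_cast; rw [abs_of_nonneg (by positivity)]
  simp only [e1, e2]
  have e3 : (1 + 2 / l) = 1 + 1 / l + 1 / l := by ring
  rw [e3, ENNReal.ofReal_add (by positivity) (by positivity),
    ENNReal.ofReal_add (by positivity) (by positivity)]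
  gcongr
  simp

/-- Translating n by ⌊x/l⌋ leaves a remainder in [0,l), which changes each term by a factor of at
most (1+l)². The bound is therefore uniform in x. -/
theorem tsum_int_shift_le {l : ℝ} (hl : 0 < l) (x : ℝ) :
    ∑' n : ℤ, ENNReal.ofReal (((1 + |x + l * n|) ^ 2)⁻¹)
      ≤ ENNReal.ofReal ((1 + l) ^ 2 * (1 + 2 / l)) := by
  rw [← (Equiv.subRight ⌊x / l⌋).tsum_eq]
  rw [ENNReal.ofReal_mul (by positivity)]
  refine le_trans ?_ (mul_le_mul_right (tsum_int_abs_mul_le hl) _)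
  rw [← ENNReal.tsum_mul_left]
  refine ENNReal.tsum_le_tsum fun n => ?_
  rw [← ENNReal.ofReal_mul (by positivity)]
  refine ENNReal.ofReal_le_ofReal ?_
  have hx : x + l * ((Equiv.subRight ⌊x / l⌋ n : ℤ) : ℝ) = l * n + l * Int.fract (x / l) := by
    simp only [Equiv.subRight_apply, Int.cast_sub, Int.fract]
    field_simp; ring
  rw [hx]
  have h0 := Int.fract_nonneg (x / l)
  have h1 := (Int.fract_lt_one (x / l)).le
  set z := l * n + l * Int.fract (x / l)
  have h2 : l * |(n : ℝ)| ≤ |z| + l := by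
    have : l * |(n : ℝ)| = |z - l * Int.fract (x / l)| := by
      simp [z, abs_mul, abs_of_pos hl]
    rw [this]
    refine (abs_sub _ _).trans ?_
    rw [abs_of_nonneg (a := l * _) (by positivity)]
    gcongr; nlinarith
  have h3 : 1 + l * |(n : ℝ)| ≤ (1 + l) * (1 + |z|) := by nlinarith [abs_nonneg z]
  rw [← div_eq_mul_inv, inv_eq_one_div, div_le_div_iff₀ (by positivity) (by positivity), one_mul,
    ← mul_pow]
  gcongr

/-! ### Sums along a sheared lattice -/

/-- The distance to the nearest integer. -/
noncomputable abbrev circleNorm (s : ℝ) : ℝ := ‖(s : UnitAddCircle)‖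

theorem circleNorm_le_abs (s : ℝ) : circleNorm s ≤ |s| := by
  rw [circleNorm, UnitAddCircle.norm_eq]
  simpa using round_le s 0

theorem circleNorm_add_intCast (s : ℝ) (n : ℤ) : circleNorm (s + n) = circleNorm s := by
  simp [circleNorm]

theorem circleNorm_add_le (s t : ℝ) : circleNorm (s + t) ≤ circleNorm s + |t| := by
  have : ((s + t : ℝ) : UnitAddCircle) = s + t := by simp
  rw [circleNorm, this]
  exact (norm_add_le _ _).trans (by gcongr; exact circleNorm_le_abs t)

theorem continuous_circleNorm : Continuous circleNorm :=
  continuous_norm.comp (AddCircle.continuous_mk' 1)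

/-- The weighted number of points `(rb, (u(b - 2y) - n)/r)` near the origin, `b, n ∈ ℤ`. -/
noncomputable def shearSum (A : ℕ) (r y u : ℝ) : ℝ≥0∞ :=
  ∑' b : ℤ, ENNReal.ofReal
    (((1 + r * |(b : ℝ)|) ^ A * (1 + circleNorm (u * (b - 2 * y)) / r) ^ A)⁻¹)

theorem measurable_shearSum (A : ℕ) (r y : ℝ) : Measurable (shearSum A r y) := by
  unfold shearSum
  refine Measurable.tsum fun b => ENNReal.measurable_ofReal.comp (Continuous.measurable ?_ |>.inv)
  have := continuous_circleNorm
  fun_prop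

/-- The points (X₁,X₂) lie in a translate of a lattice of covolume one, in which (rq, (uq-p)/r) is a
primitive vector of sup norm l. On a line parallel to it the points are spaced by l, so each line
contributes O(1/l); a line is far from the origin when its determinant with this vector, an element
of θ + ℤ, is large compared with l. Of the exponent A+4, A yields the decay in ‖θ‖/l, two powers sum
over the lines and two along a line. -/
theorem shearSum_le_of_coprime (A : ℕ) {r : ℝ} (hr : 0 < r) (y u : ℝ) {p : ℤ} {q : ℕ}
    (hq : 0 < q) (hpq : IsCoprime (q : ℤ) p) {l : ℝ} (hl : l = max (r * q) (|u * q - p| / r))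
    (hl1 : l ≤ 1) :
    shearSum (A + 4) r y u ≤
      ENNReal.ofReal (144 / l * ((1 + circleNorm (2 * u * q * y) / l) ^ A)⁻¹) := by
  have hqr : (0 : ℝ) < q := by exact_mod_cast hq
  have hl0 : 0 < l := hl ▸ lt_max_of_lt_left (by positivity)
  set θ := 2 * u * q * y with hθ
  set P : ℤ → ℤ := fun b => round (u * (b - 2 * y)) with hP
  -- `N b` labels the line through the point of index b: `N b + θ` is the determinant of that point
  -- and the short vector.
  set N : ℤ → ℤ := fun b => q * P b - b * p with hN
  set X₁ : ℤ → ℝ := fun b => r * b with hX₁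
  set X₂ : ℤ → ℝ := fun b => (u * (b - 2 * y) - P b) / r with hX₂
  have hr1 : r * q ≤ l := hl ▸ le_max_left _ _
  have hr2 : |u * q - p| / r ≤ l := hl ▸ le_max_right _ _
  -- the determinant identity
  have hD : ∀ b, |(N b : ℝ) + θ| ≤ l * (|X₁ b| + |X₂ b|) := by
    intro b
    have e : (N b : ℝ) + θ = X₁ b * ((u * q - p) / r) - (r * q) * X₂ b := by
      simp only [hN, hX₁, hX₂, hθ]; push_cast; field_simp; ring
    rw [e]
    refine (abs_sub _ _).trans ?_
    rw [abs_mul (X₁ b), abs_mul (r * q), abs_div, abs_of_pos hr, abs_of_pos (mul_pos hr hqr),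
      mul_add, mul_comm |X₁ b|]
    gcongr
  have hθN : ∀ n : ℤ, circleNorm θ ≤ |(n : ℝ) + θ| := by
    intro n
    have := circleNorm_le_abs (θ + n)
    rwa [circleNorm_add_intCast, add_comm] at this
  have hc0 : 0 ≤ circleNorm θ := norm_nonneg _
  -- bound of one term
  have hterm : ∀ b : ℤ, ((1 + r * |(b : ℝ)|) ^ (A + 4) *
      (1 + circleNorm (u * (b - 2 * y)) / r) ^ (A + 4))⁻¹ ≤
      ((1 + circleNorm θ / l) ^ A)⁻¹ * (((1 + |(N b : ℝ) + θ|) ^ 2)⁻¹ *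
        (((1 + |X₁ b|) ^ 2)⁻¹ * ((1 + |X₂ b|) ^ 2)⁻¹)) := by
    intro b
    have e1 : r * |(b : ℝ)| = |X₁ b| := by simp [hX₁, abs_mul, abs_of_pos hr]
    have e2 : circleNorm (u * (b - 2 * y)) / r = |X₂ b| := by
      rw [circleNorm, UnitAddCircle.norm_eq]; simp only [hX₂, hP, abs_div, abs_of_pos hr]
    rw [e1, e2, ← mul_inv, ← mul_inv, ← mul_inv]
    refine inv_anti₀ (by positivity) ?_
    have f0 := hD b
    have f1 : |(N b : ℝ) + θ| / l ≤ |X₁ b| + |X₂ b| := by rwa [div_le_iff₀' hl0]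
    have f2 : |(N b : ℝ) + θ| ≤ |(N b : ℝ) + θ| / l := by
      rw [le_div_iff₀ hl0]; nlinarith [abs_nonneg ((N b : ℝ) + θ)]
    have f3 : circleNorm θ / l ≤ |(N b : ℝ) + θ| / l := by gcongr; exact hθN _
    have f4 : 1 + (|X₁ b| + |X₂ b|) ≤ (1 + |X₁ b|) * (1 + |X₂ b|) := by
      nlinarith [abs_nonneg (X₁ b), abs_nonneg (X₂ b)]
    have f5 : 0 ≤ circleNorm θ / l := by positivity
    have f6 : 1 + circleNorm θ / l ≤ (1 + |X₁ b|) * (1 + |X₂ b|) := by linarith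
    have f7 : 1 + |(N b : ℝ) + θ| ≤ (1 + |X₁ b|) * (1 + |X₂ b|) := by linarith
    calc (1 + circleNorm θ / l) ^ A * ((1 + |(N b : ℝ) + θ|) ^ 2 * ((1 + |X₁ b|) ^ 2 * (1 + |X₂ b|) ^ 2))
        ≤ ((1 + |X₁ b|) * (1 + |X₂ b|)) ^ A * (((1 + |X₁ b|) * (1 + |X₂ b|)) ^ 2 *
          ((1 + |X₁ b|) ^ 2 * (1 + |X₂ b|) ^ 2)) := by gcongr
      _ = _ := by rw [← mul_pow (1 + |X₁ b|) (1 + |X₂ b|) (A + 4)]; ring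
  -- the sum over one fibre
  have hfib : ∀ n : ℤ, ∑' b : (N ⁻¹' {n}), ENNReal.ofReal
      (((1 + |X₁ b|) ^ 2)⁻¹ * ((1 + |X₂ b|) ^ 2)⁻¹) ≤ ENNReal.ofReal (12 / l) := by
    intro n
    rcases isEmpty_or_nonempty (N ⁻¹' {n}) with he | ⟨⟨b₀, hb₀⟩⟩
    · simp
    have hb₀ : N b₀ = n := hb₀
    -- On one line, q(P b - P b₀) = (b - b₀)p, and coprimality makes the difference an integer
    -- multiple of (q,p): the points are translates by multiples of the short vector.
    have hex : ∀ b : (N ⁻¹' {n}), ∃ m : ℤ, (b : ℤ) = b₀ + q * m ∧ P b = P b₀ + p * m := by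
      rintro ⟨b, hb⟩
      have hb : N b = n := hb
      have h1 : (q : ℤ) * (P b - P b₀) = (b - b₀) * p := by
        have : N b = N b₀ := by rw [hb, hb₀]
        simp only [hN] at this
        linear_combination this
      have h2 : (q : ℤ) ∣ b - b₀ := hpq.dvd_of_dvd_mul_right ⟨_, h1.symm⟩
      obtain ⟨m, hm⟩ := h2
      refine ⟨m, by linarith, ?_⟩
      rw [hm] at h1
      have hq0 : (q : ℤ) ≠ 0 := by exact_mod_cast hq.ne'
      have : P b - P b₀ = m * p := mul_left_cancel₀ hq0 (by rw [h1]; ring)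
      linarith
    choose m hm1 hm2 using hex
    have hinj : Function.Injective m := by
      intro b b' h
      apply Subtype.ext
      rw [hm1, hm1, h]
    have hl12 : (1 + l) ^ 2 * (1 + 2 / l) ≤ 12 / l := by
      rw [le_div_iff₀ hl0]
      have : (1 + l) ^ 2 * (1 + 2 / l) * l = (1 + l) ^ 2 * (l + 2) := by field_simp
      rw [this]; nlinarith [mul_pos hl0 hl0]
    have main : ∀ (x : ℝ) (s : ℝ), |s| = l → (∀ b : (N ⁻¹' {n}),
        ((1 + |X₁ b|) ^ 2)⁻¹ * ((1 + |X₂ b|) ^ 2)⁻¹ ≤ ((1 + |x + s * m b|) ^ 2)⁻¹) →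
        ∑' b : (N ⁻¹' {n}), ENNReal.ofReal
          (((1 + |X₁ b|) ^ 2)⁻¹ * ((1 + |X₂ b|) ^ 2)⁻¹) ≤ ENNReal.ofReal (12 / l) := by
      intro x s hs h
      calc _ ≤ ∑' b : (N ⁻¹' {n}), ENNReal.ofReal (((1 + |x + s * m b|) ^ 2)⁻¹) :=
            ENNReal.tsum_le_tsum fun b => ENNReal.ofReal_le_ofReal (h b)
        _ ≤ ∑' k : ℤ, ENNReal.ofReal (((1 + |x + s * k|) ^ 2)⁻¹) :=
            ENNReal.tsum_comp_le_tsum_of_injective hinj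
              (fun k : ℤ => ENNReal.ofReal (((1 + |x + s * k|) ^ 2)⁻¹))
        _ ≤ ENNReal.ofReal ((1 + l) ^ 2 * (1 + 2 / l)) := by
            rcases (abs_eq hl0.le).1 hs with h | h
            · rw [h]; exact tsum_int_shift_le hl0 x
            · rw [h, ← (Equiv.neg ℤ).tsum_eq]
              simpa using tsum_int_shift_le hl0 x
        _ ≤ _ := ENNReal.ofReal_le_ofReal hl12
    -- Sum with the coordinate in which the short vector attains its sup norm l; the weight of the
    -- other coordinate is at most 1.
    rcases le_total (|u * q - p| / r) (r * q) with h | h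
    · have hl' : l = r * q := by rw [hl, max_eq_left h]
      refine main (X₁ b₀) (r * q) (by rw [abs_of_pos (by positivity), hl']) fun b => ?_
      have : X₁ b₀ + r * q * m b = X₁ b := by simp only [hX₁, hm1]; push_cast; ring
      rw [this]
      refine mul_le_of_le_one_right (by positivity) (inv_le_one_of_one_le₀ ?_)
      exact one_le_pow₀ (by linarith [abs_nonneg (X₂ b)])
    · have hl' : l = |u * q - p| / r := by rw [hl, max_eq_right h]
      refine main (X₂ b₀) ((u * q - p) / r) (by rw [abs_div, abs_of_pos hr, hl']) fun b => ?_
      have : X₂ b₀ + (u * q - p) / r * m b = X₂ b := by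
        simp only [hX₂, hm2]; rw [hm1]; push_cast; ring
      rw [this]
      refine mul_le_of_le_one_left (by positivity) (inv_le_one_of_one_le₀ ?_)
      exact one_le_pow₀ (by linarith [abs_nonneg (X₁ b)])
  have hsum : ∑' n : ℤ, ENNReal.ofReal (((1 + |(n : ℝ) + θ|) ^ 2)⁻¹) ≤ ENNReal.ofReal 12 := by
    have := tsum_int_shift_le one_pos θ
    simp only [one_mul, add_comm θ] at this
    exact this.trans (ENNReal.ofReal_le_ofReal (by norm_num))
  unfold shearSum
  calc _ ≤ ∑' b : ℤ, ENNReal.ofReal (((1 + circleNorm θ / l) ^ A)⁻¹) *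
        (ENNReal.ofReal (((1 + |(N b : ℝ) + θ|) ^ 2)⁻¹) *
        ENNReal.ofReal (((1 + |X₁ b|) ^ 2)⁻¹ * ((1 + |X₂ b|) ^ 2)⁻¹)) := by
        refine ENNReal.tsum_le_tsum fun b => ?_
        rw [← ENNReal.ofReal_mul (by positivity), ← ENNReal.ofReal_mul (by positivity)]
        exact ENNReal.ofReal_le_ofReal (hterm b)
    _ = ENNReal.ofReal (((1 + circleNorm θ / l) ^ A)⁻¹) * ∑' n : ℤ,
        ENNReal.ofReal (((1 + |(n : ℝ) + θ|) ^ 2)⁻¹) * ∑' b : (N ⁻¹' {n}),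
        ENNReal.ofReal (((1 + |X₁ b|) ^ 2)⁻¹ * ((1 + |X₂ b|) ^ 2)⁻¹) := by
        rw [ENNReal.tsum_mul_left, ← ENNReal.tsum_fiberwise _ N]
        congr 1
        refine tsum_congr fun n => ?_
        rw [← ENNReal.tsum_mul_left]
        refine tsum_congr fun b => ?_
        rw [show N b = n from b.2]
    _ ≤ ENNReal.ofReal (((1 + circleNorm θ / l) ^ A)⁻¹) *
        (ENNReal.ofReal 12 * ENNReal.ofReal (12 / l)) := by
        gcongr
        refine le_trans ?_ (mul_le_mul_left hsum _)
        rw [← ENNReal.tsum_mul_right]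
        exact ENNReal.tsum_le_tsum fun n => by gcongr; exact hfib n
    _ = _ := by
        rw [← ENNReal.ofReal_mul (by positivity), ← ENNReal.ofReal_mul (by positivity)]
        congr 1; ring

/-! ### Well separated integers -/

/-- The map p ↦ ⌊p/L⌋ is injective on S. The hypothesis L ≤ p keeps its values positive, so the
bound is P/L without an extra 1; this matters when L exceeds P. -/
theorem card_mul_le_of_separated {L P : ℝ} (hL : 0 < L) (S : Finset ℕ)
    (h0 : ∀ p ∈ S, L ≤ p) (hP : ∀ p ∈ S, (p : ℝ) ≤ P)
    (hsep : ∀ p ∈ S, ∀ p' ∈ S, p < p' → L ≤ (p' : ℝ) - p) (hP0 : 0 ≤ P) :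
    (S.card : ℝ) ≤ P / L := by
  have hinj : Set.InjOn (fun p : ℕ => ⌊(p : ℝ) / L⌋₊) S := by
    have aux : ∀ p ∈ S, ∀ p' ∈ S, p < p' → ⌊(p : ℝ) / L⌋₊ < ⌊(p' : ℝ) / L⌋₊ := by
      intro p hp p' hp' hlt
      rw [← Nat.add_one_le_iff, Nat.le_floor_iff (by positivity)]
      have h1 := Nat.floor_le (a := (p : ℝ) / L) (by positivity)
      have h2 : (p : ℝ) / L + 1 ≤ p' / L := by
        rw [le_div_iff₀ hL, add_mul, div_mul_cancel₀ _ hL.ne']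
        linarith [hsep p hp p' hp' hlt]
      push_cast; linarith
    intro p hp p' hp' h
    rcases lt_trichotomy p p' with hl | hl | hl
    · exact absurd h (aux p hp p' hp' hl).ne
    · exact hl
    · exact absurd h (aux p' hp' p hp hl).ne'
  have hmaps : ∀ p ∈ S, ⌊(p : ℝ) / L⌋₊ ∈ Finset.Icc 1 ⌊P / L⌋₊ := by
    intro p hp
    rw [Finset.mem_Icc, Nat.le_floor_iff (by positivity)]
    refine ⟨?_, Nat.floor_le_floor (by gcongr; exact hP p hp)⟩
    rw [Nat.cast_one, le_div_iff₀ hL, one_mul]; exact h0 p hp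
  have := Finset.card_le_card_of_injOn _ hmaps hinj
  rw [Nat.card_Icc, Nat.add_sub_cancel] at this
  calc (S.card : ℝ) ≤ (⌊P / L⌋₊ : ℝ) := by exact_mod_cast this
    _ ≤ P / L := Nat.floor_le (by positivity)

/-- If ρ(p) and ρ(p') are at most t, then ρ(p'-p) ≤ 2t, so p'-p is at least L = (c/2t)^(1/ν), and p
itself is at least L. Hence at most P/L integers up to P have ρ ≤ t. With t = 2^(-s), the dyadic
pieces of the sum are dominated by P times a geometric series of ratio 2^(σ-1/ν) < 1. -/
theorem exists_sum_rpow_neg_le (ρ : ℕ → ℝ) {c ν σ : ℝ} (hc : 0 < c) (hν : 0 < ν) (hσ0 : 0 ≤ σ)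
    (hσ : σ < 1 / ν) (hρ : ∀ p : ℕ, 0 < p → c * (p : ℝ) ^ (-ν) ≤ ρ p) (hρ1 : ∀ p, ρ p ≤ 1)
    (hsub : ∀ p p' : ℕ, p < p' → ρ (p' - p) ≤ ρ p + ρ p') :
    ∃ C : ℝ, 0 ≤ C ∧ ∀ P : ℝ, 0 ≤ P →
      ∑ p ∈ Finset.Icc 1 ⌊P⌋₊, ENNReal.ofReal (ρ p ^ (-σ)) ≤ ENNReal.ofReal (C * P) := by
  classical
  set x : ℝ := (2 : ℝ) ^ (σ - 1 / ν) with hx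
  have hx0 : 0 < x := by positivity
  have hx1 : x < 1 := Real.rpow_lt_one_of_one_lt_of_neg (by norm_num) (by linarith)
  -- The factor 2^σ comes from ρ > 2^(-(s+1)) on the piece s, and (2/c)^(1/ν) from the separation at
  -- t = 2^(-s).
  set D : ℝ := 2 ^ σ * (2 / c) ^ (1 / ν) with hD
  refine ⟨D * (1 - x)⁻¹, by have : 0 < 1 - x := by linarith
                            positivity, fun P hP => ?_⟩
  have hρ0 : ∀ p ∈ Finset.Icc 1 ⌊P⌋₊, 0 < ρ p := fun p hp =>
    lt_of_lt_of_le (by have := (Finset.mem_Icc.1 hp).1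
                       positivity) (hρ p (Finset.mem_Icc.1 hp).1)
  have hlow : ∀ (n : ℕ) (t : ℝ), 0 < n → 0 < t → ρ n ≤ 2 * t → (c / (2 * t)) ^ (1 / ν) ≤ n := by
    intro n t hn ht h
    have hn' : (0 : ℝ) < n := by exact_mod_cast hn
    have h1 := (hρ n hn).trans h
    rw [Real.rpow_neg hn'.le, ← div_eq_mul_inv, div_le_iff₀ (by positivity)] at h1
    rw [one_div, Real.rpow_inv_le_iff_of_pos (by positivity) hn'.le hν, div_le_iff₀' (by positivity)]
    exact h1
  have hcard : ∀ s : ℕ, (((Finset.Icc 1 ⌊P⌋₊).filter (fun p => ρ p ≤ (1 / 2 : ℝ) ^ s)).card : ℝ)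
      ≤ P / (c / (2 * (1 / 2 : ℝ) ^ s)) ^ (1 / ν) := by
    intro s
    have ht : (0 : ℝ) < (1 / 2 : ℝ) ^ s := by positivity
    refine card_mul_le_of_separated (by positivity) _ ?_ ?_ ?_ hP
    · intro p hp
      rw [Finset.mem_filter, Finset.mem_Icc] at hp
      exact hlow p _ hp.1.1 ht (by linarith [hp.2])
    · intro p hp
      rw [Finset.mem_filter, Finset.mem_Icc] at hp
      exact (Nat.cast_le.2 hp.1.2).trans (Nat.floor_le hP)
    · intro p hp p' hp' hlt
      rw [Finset.mem_filter, Finset.mem_Icc] at hp hp'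
      rw [← Nat.cast_sub hlt.le]
      exact hlow _ _ (by omega) ht (by linarith [hsub p p' hlt, hp.2, hp'.2])
  have hterm : ∀ p ∈ Finset.Icc 1 ⌊P⌋₊, ENNReal.ofReal (ρ p ^ (-σ)) ≤
      ∑' s : ℕ, (if ρ p ≤ (1 / 2 : ℝ) ^ s then ENNReal.ofReal ((2 ^ (s + 1) : ℝ) ^ σ) else 0) := by
    intro p hp
    obtain ⟨s, hs1, hs2⟩ := exists_nat_pow_near_of_lt_one (hρ0 p hp) (hρ1 p)
      (by norm_num : (0 : ℝ) < 1 / 2) (by norm_num)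
    refine le_trans ?_ (ENNReal.le_tsum s)
    rw [if_pos hs2]
    refine ENNReal.ofReal_le_ofReal ?_
    rw [Real.rpow_neg (hρ0 p hp).le, ← Real.inv_rpow (hρ0 p hp).le]
    refine Real.rpow_le_rpow (inv_nonneg.2 (hρ0 p hp).le) ?_ hσ0
    rw [inv_le_comm₀ (hρ0 p hp) (by positivity)]
    simpa using hs1.le
  calc _ ≤ ∑ p ∈ Finset.Icc 1 ⌊P⌋₊, ∑' s : ℕ,
        (if ρ p ≤ (1 / 2 : ℝ) ^ s then ENNReal.ofReal ((2 ^ (s + 1) : ℝ) ^ σ) else 0) :=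
        Finset.sum_le_sum hterm
    _ = ∑' s : ℕ, ∑ p ∈ Finset.Icc 1 ⌊P⌋₊,
        (if ρ p ≤ (1 / 2 : ℝ) ^ s then ENNReal.ofReal ((2 ^ (s + 1) : ℝ) ^ σ) else 0) :=
        (Summable.tsum_finsetSum fun _ _ => ENNReal.summable).symm
    _ ≤ ∑' s : ℕ, ENNReal.ofReal (D * P * x ^ s) := by
        refine ENNReal.tsum_le_tsum fun s => ?_
        rw [← Finset.sum_filter, Finset.sum_const, nsmul_eq_mul, ← ENNReal.ofReal_natCast,
          ← ENNReal.ofReal_mul (by positivity)]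
        refine ENNReal.ofReal_le_ofReal ((mul_le_mul_of_nonneg_right (hcard s)
          (by positivity)).trans_eq ?_)
        have e1 : c / (2 * (1 / 2 : ℝ) ^ s) = (2 / c)⁻¹ * 2 ^ s := by
          rw [one_div, inv_pow]; field_simp
        have e2 : x ^ s = ((2 : ℝ) ^ s) ^ σ / ((2 : ℝ) ^ s) ^ (1 / ν) := by
          rw [hx, ← Real.rpow_natCast, ← Real.rpow_natCast, ← Real.rpow_mul (by norm_num),
            ← Real.rpow_mul (by norm_num), ← Real.rpow_mul (by norm_num),
            ← Real.rpow_sub (by norm_num)]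
          congr 1; ring
        rw [e1, e2, hD, pow_succ, Real.mul_rpow (by positivity) (by positivity),
          Real.mul_rpow (by positivity) (by positivity), Real.inv_rpow (by positivity)]
        field_simp
    _ = ENNReal.ofReal (D * (1 - x)⁻¹ * P) := by
        rw [← ENNReal.ofReal_tsum_of_nonneg (fun s => by positivity)
          ((summable_geometric_of_lt_one hx0.le hx1).mul_left _), tsum_mul_left,
          tsum_geometric_of_lt_one hx0.le hx1]
        congr 1; ring

/-! ### Simultaneous approximation -/

/-- The distance of `2 p y` to the nearest integer vector. -/
noncomputable def doubleDist {d : ℕ} (y : RVec d) (p : ℤ) : ℝ :=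
  ‖fun i : Fin d => ((2 * p * y i : ℝ) : UnitAddCircle)‖

theorem doubleDist_neg {d : ℕ} (y : RVec d) (p : ℤ) : doubleDist y (-p) = doubleDist y p := by
  have : (fun i : Fin d => ((2 * ((-p : ℤ) : ℝ) * y i : ℝ) : UnitAddCircle)) =
      -(fun i : Fin d => ((2 * p * y i : ℝ) : UnitAddCircle)) := by
    funext i; rw [Pi.neg_apply, ← AddCircle.coe_neg]; congr 1; push_cast; ring
  rw [doubleDist, this, norm_neg, doubleDist]

theorem doubleDist_sub_le {d : ℕ} (y : RVec d) (p p' : ℤ) :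
    doubleDist y (p' - p) ≤ doubleDist y p + doubleDist y p' := by
  have : (fun i : Fin d => ((2 * ((p' - p : ℤ) : ℝ) * y i : ℝ) : UnitAddCircle)) =
      (fun i : Fin d => ((2 * p' * y i : ℝ) : UnitAddCircle)) -
      (fun i : Fin d => ((2 * p * y i : ℝ) : UnitAddCircle)) := by
    funext i; rw [Pi.sub_apply, ← AddCircle.coe_sub]; congr 1; push_cast; ring
  rw [doubleDist, this, add_comm]
  exact norm_sub_le _ _

theorem doubleDist_le_one {d : ℕ} (y : RVec d) (p : ℤ) : doubleDist y p ≤ 1 := by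
  refine (pi_norm_le_iff_of_nonneg zero_le_one).2 fun i => ?_
  rw [UnitAddCircle.norm_eq]
  exact (abs_sub_round _).trans (by norm_num)

/-- The Diophantine condition is applied with denominator 2p; multiplying by 2p lowers the exponent
from κ to κ-1. -/
theorem IsDiophantineVec.le_doubleDist {d : ℕ} {κ : ℝ} {y : RVec d} (hy : IsDiophantineVec κ y) :
    ∃ c : ℝ, 0 < c ∧ ∀ p : ℕ, 0 < p → c * (p : ℝ) ^ (-(κ - 1)) ≤ doubleDist y p := by
  obtain ⟨C, hC, h⟩ := hy
  refine ⟨C * 2 ^ (-(κ - 1)), by positivity, fun p hp => ?_⟩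
  have hp' : (0 : ℝ) < p := by exact_mod_cast hp
  obtain ⟨j, hj⟩ := h (fun i => round (2 * p * y i)) (2 * p) (by positivity)
  refine le_trans ?_ (norm_le_pi_norm _ j)
  rw [UnitAddCircle.norm_eq]
  push_cast at hj ⊢
  have e : |y j - round (2 * p * y j) / (2 * p : ℝ)| * (2 * p)
      = |2 * p * y j - round (2 * p * y j)| := by
    rw [← abs_of_pos (show (0 : ℝ) < 2 * p by positivity), ← abs_mul,
      abs_of_pos (show (0 : ℝ) < 2 * p by positivity)]
    congr 1; field_simp
  rw [← e, mul_assoc, ← Real.mul_rpow (by positivity) (by positivity), neg_sub,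
    Real.rpow_sub (by positivity), Real.rpow_one]
  rw [mul_div_assoc', mul_div_right_comm]
  gcongr

theorem IsDiophantineVec.mono {d : ℕ} {κ κ' : ℝ} {y : RVec d} (hy : IsDiophantineVec κ y)
    (h : κ ≤ κ') : IsDiophantineVec κ' y := by
  obtain ⟨C, hC, hm⟩ := hy
  refine ⟨C, hC, fun m q hq => ?_⟩
  obtain ⟨j, hj⟩ := hm m q hq
  refine ⟨j, lt_of_le_of_lt ?_ hj⟩
  have : (1 : ℝ) ≤ q := by exact_mod_cast hq
  gcongr

/-- Replacing 2uqy_i by 2py_i costs at most 2|y_i||uq-p| ≤ 2|y_i|l, hence only a constant factor.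
What remains depends on u through l alone, so that the sum over p and the integral over u can be
separated. -/
theorem prod_shearSum_le {d : ℕ} (y : RVec d) : ∃ K : ℝ, 0 < K ∧ ∀ {r : ℝ}, 0 < r → r ≤ 1 →
    ∀ (u : ℝ) {p : ℤ} {q : ℕ}, 0 < q → IsCoprime (q : ℤ) p → ∀ {l : ℝ},
    l = max (r * q) (|u * q - p| / r) → l ≤ 1 →
    ∏ i, shearSum (d + 4) r (y i) u ≤
      ENNReal.ofReal (K * ((l ^ d)⁻¹ * ((1 + doubleDist y p / l) ^ d)⁻¹)) := by
  refine ⟨∏ i, (144 * (1 + 2 * |y i|) ^ d), Finset.prod_pos fun i _ => by positivity, ?_⟩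
  intro r hr hr1 u p q hq hpq l hl hl1
  have hqr : (0 : ℝ) < q := by exact_mod_cast hq
  have hl0 : 0 < l := hl ▸ lt_max_of_lt_left (by positivity)
  have hr2 : |u * q - p| / r ≤ l := hl ▸ le_max_right _ _
  have h1 : ∀ i, shearSum (d + 4) r (y i) u ≤ ENNReal.ofReal
      (144 * (1 + 2 * |y i|) ^ d * (l⁻¹ * ((1 + circleNorm (2 * p * y i) / l) ^ d)⁻¹)) := by
    intro i
    refine (shearSum_le_of_coprime d hr (y i) u hq hpq hl hl1).trans (ENNReal.ofReal_le_ofReal ?_)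
    have hc : circleNorm (2 * p * y i) ≤ circleNorm (2 * u * q * y i) + 2 * |y i| * l := by
      have e : 2 * p * y i = 2 * u * q * y i + -(2 * (u * q - p) * y i) := by ring
      rw [e]
      refine (circleNorm_add_le _ _).trans ?_
      gcongr
      rw [abs_neg, abs_mul, abs_mul, abs_two, mul_right_comm]
      gcongr
      rw [div_le_iff₀ hr] at hr2
      exact hr2.trans (by nlinarith)
    have h0 : 0 ≤ circleNorm (2 * u * q * y i) := norm_nonneg _
    have h0' : 0 ≤ circleNorm (2 * p * y i) := norm_nonneg _
    have h2 : 1 + circleNorm (2 * p * y i) / l ≤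
        (1 + 2 * |y i|) * (1 + circleNorm (2 * u * q * y i) / l) := by
      have : circleNorm (2 * p * y i) / l ≤ circleNorm (2 * u * q * y i) / l + 2 * |y i| := by
        rw [div_add' _ _ _ hl0.ne']; gcongr
      nlinarith [abs_nonneg (y i), div_nonneg h0 hl0.le,
        mul_nonneg (abs_nonneg (y i)) (div_nonneg h0 hl0.le)]
    have h3 : ((1 + circleNorm (2 * u * q * y i) / l) ^ d)⁻¹ ≤
        (1 + 2 * |y i|) ^ d * ((1 + circleNorm (2 * p * y i) / l) ^ d)⁻¹ := by
      rw [← div_eq_mul_inv, inv_eq_one_div, div_le_div_iff₀ (by positivity) (by positivity),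
        one_mul, ← mul_pow]
      gcongr
    calc _ ≤ 144 / l * ((1 + 2 * |y i|) ^ d * ((1 + circleNorm (2 * p * y i) / l) ^ d)⁻¹) := by
          gcongr
      _ = _ := by ring
  have hnn : ∀ i : Fin d, 0 ≤ circleNorm (2 * p * y i) := fun i => norm_nonneg _
  refine (Finset.prod_le_prod' fun i _ => h1 i).trans ?_
  rw [← ENNReal.ofReal_prod_of_nonneg (fun i _ => by have := hnn i; positivity)]
  refine ENNReal.ofReal_le_ofReal ?_
  have e : ∏ i, (l⁻¹ * ((1 + circleNorm (2 * p * y i) / l) ^ d)⁻¹) =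
      (l ^ d)⁻¹ * ((∏ i, (1 + circleNorm (2 * p * y i) / l)) ^ d)⁻¹ := by
    rw [Finset.prod_mul_distrib, Finset.prod_const, Finset.card_univ,
      Fintype.card_fin, inv_pow, Finset.prod_inv_distrib, Finset.prod_pow]
  rw [Finset.prod_mul_distrib, e]
  have hd0 : 0 ≤ doubleDist y p := norm_nonneg _
  have h4 : 1 + doubleDist y p / l ≤ ∏ i, (1 + circleNorm (2 * p * y i) / l) := by
    have hone : ∀ i : Fin d, 1 ≤ 1 + circleNorm (2 * p * y i) / l := fun i => by
      have := hnn i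
      simp only [le_add_iff_nonneg_right]; positivity
    have hprod : (1 : ℝ) ≤ ∏ i, (1 + circleNorm (2 * p * y i) / l) :=
      Finset.one_le_prod fun j _ => hone j
    rw [← le_sub_iff_add_le', div_le_iff₀ hl0]
    refine (pi_norm_le_iff_of_nonneg (mul_nonneg (by linarith) hl0.le)).2 fun i => ?_
    rw [← div_le_iff₀ hl0, le_sub_iff_add_le']
    classical
    rw [← Finset.mul_prod_erase _ _ (Finset.mem_univ i)]
    exact le_mul_of_one_le_right (by linarith [hone i]) (Finset.one_le_prod fun j _ => hone j)
  have hpos : (0 : ℝ) ≤ ∏ i, (144 * (1 + 2 * |y i|) ^ d) := Finset.prod_nonneg fun i _ => by positivity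
  gcongr

/-! ### The mean over long horocycles -/

theorem lintegral_comp_affine {a : ℝ} (ha : a ≠ 0) (b : ℝ) {h : ℝ → ℝ≥0∞} (hh : Measurable h) :
    ∫⁻ u, h (a * u + b) = ENNReal.ofReal |a⁻¹| * ∫⁻ x, h x := by
  have h1 : ∫⁻ u, h (a * u + b) = ∫⁻ x, h (x + b) ∂(Measure.map (a * ·) volume) := by
    rw [lintegral_map (by fun_prop) (by fun_prop)]
  rw [h1, Real.map_volume_mul_left ha, lintegral_smul_measure, lintegral_add_right_eq_self h b,
    smul_eq_mul]

/-- Bernoulli's inequality for the exponent 1-a in (0,1] gives (m-1)^(1-a) ≤ m^(1-a) - (1-a)m^(-a),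
which telescopes. -/
theorem sum_rpow_neg_le {a : ℝ} (ha0 : 0 ≤ a) (ha1 : a < 1) (N : ℕ) :
    ∑ q ∈ Finset.Icc 1 N, (q : ℝ) ^ (-a) ≤ (N : ℝ) ^ (1 - a) / (1 - a) := by
  have hb : 0 < 1 - a := by linarith
  induction N with
  | zero => simp [Real.zero_rpow hb.ne']
  | succ n ih =>
    rw [Finset.sum_Icc_succ_top (by omega)]
    have hn : (0 : ℝ) < ((n + 1 : ℕ) : ℝ) := by positivity
    set m : ℝ := ((n + 1 : ℕ) : ℝ) with hm
    have hm1 : 1 ≤ m := by simp [hm]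
    have h1 : (1 + -1 / m) ^ (1 - a) ≤ 1 + (1 - a) * (-1 / m) := by
      refine rpow_one_add_le_one_add_mul_self ?_ hb.le (by linarith)
      rw [le_div_iff₀ hn]; linarith
    have h2 : (n : ℝ) = m * (1 + -1 / m) := by
      simp only [hm]; push_cast; field_simp; ring
    have h3 : (n : ℝ) ^ (1 - a) ≤ m ^ (1 - a) - (1 - a) * m ^ (-a) := by
      rw [h2, Real.mul_rpow hn.le (by rw [neg_div, ← sub_eq_add_neg, sub_nonneg, div_le_one hn]; exact hm1)]
      refine (mul_le_mul_of_nonneg_left h1 (by positivity)).trans_eq ?_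
      have : m ^ (-a) = m ^ (1 - a) / m := by
        rw [← Real.rpow_sub_one hn.ne']; congr 1; ring
      rw [this]; ring
    calc _ ≤ (n : ℝ) ^ (1 - a) / (1 - a) + m ^ (-a) := by gcongr
      _ ≤ (m ^ (1 - a) - (1 - a) * m ^ (-a)) / (1 - a) + m ^ (-a) := by gcongr
      _ = _ := by field_simp; ring

theorem lintegral_unit_rpow_lt_top {a : ℝ} (ha : a < 1) :
    ∫⁻ x : ℝ in Set.Icc (-1) 1, ENNReal.ofReal (|x| ^ (-a)) < ⊤ := by
  have h1 : IntegrableOn (fun x : ℝ => |x| ^ (-a)) (Set.Icc 0 1) := by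
    rw [integrableOn_Icc_iff_integrableOn_Ioc]
    refine ((intervalIntegrable_iff_integrableOn_Ioc_of_le zero_le_one).1
      (intervalIntegral.intervalIntegrable_rpow' (r := -a) (by linarith))).congr_fun ?_
      measurableSet_Ioc
    intro x hx; simp only [abs_of_pos hx.1]
  have h2 : IntegrableOn (fun x : ℝ => |x| ^ (-a)) (Set.Icc (-1) 0) := by
    have := h1.comp_neg
    simpa using this
  have h3 := h2.union h1
  rw [Set.Icc_union_Icc_eq_Icc (by norm_num) (by norm_num)] at h3
  exact h3.lintegral_lt_top

/-! ### Dirichlet approximation and majorants attached to reduced fractions -/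

theorem exists_coprime_approx {r : ℝ} (hr : 0 < r) (hr1 : r ≤ 1) (u : ℝ) :
    ∃ (p : ℤ) (q : ℕ), 0 < q ∧ q ≤ ⌊1 / r⌋₊ ∧ IsCoprime (q : ℤ) p ∧ |u * q - p| ≤ r := by
  have hN : 0 < ⌊1 / r⌋₊ := Nat.floor_pos.2 (by rw [le_div_iff₀ hr]; linarith)
  obtain ⟨x, hx1, hx2⟩ := Real.exists_rat_abs_sub_le_and_den_le u hN
  refine ⟨x.num, x.den, x.den_pos, hx2, ?_, ?_⟩
  · rw [Int.isCoprime_iff_gcd_eq_one, Int.gcd_comm]; exact x.reduced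
  · have hd : (0 : ℝ) < x.den := by exact_mod_cast x.den_pos
    have e : u * x.den - x.num = (u - x) * x.den := by
      have : (x : ℝ) * x.den = x.num := by exact_mod_cast Rat.mul_den_eq_num x
      rw [sub_mul, this]
    rw [e, abs_mul, abs_of_pos hd]
    have hlt := Nat.lt_floor_add_one (1 / r)
    rw [div_lt_iff₀ hr] at hlt
    calc |u - x| * x.den ≤ 1 / (((⌊1 / r⌋₊ : ℝ) + 1) * x.den) * x.den := by gcongr
      _ = 1 / ((⌊1 / r⌋₊ : ℝ) + 1) := by field_simp
      _ ≤ r := by rw [div_le_iff₀ (by positivity)]; linarith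

/-- A majorant of the contribution of the fraction `p / q`. -/
noncomputable def fracMajorant (a r : ℝ) (q : ℕ) (p : ℤ) (u : ℝ) : ℝ≥0∞ :=
  ENNReal.ofReal ((r * q) ^ (-a)) *
    (Set.Icc (-1) 1).indicator (fun x : ℝ => ENNReal.ofReal (|x| ^ (-a))) ((u * q - p) / r)

theorem measurable_fracMajorant (a r : ℝ) (q : ℕ) (p : ℤ) : Measurable (fracMajorant a r q p) := by
  unfold fracMajorant
  refine Measurable.const_mul ?_ _
  have h : Measurable ((Set.Icc (-1) 1).indicator (fun x : ℝ => ENNReal.ofReal (|x| ^ (-a)))) :=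
    Measurable.indicator (by fun_prop) measurableSet_Icc
  exact h.comp (by fun_prop)

theorem lintegral_fracMajorant (a : ℝ) {r : ℝ} (hr : 0 < r) {q : ℕ} (hq : 0 < q) (p : ℤ) :
    ∫⁻ u, fracMajorant a r q p u = ENNReal.ofReal ((r * q) ^ (-a)) * (ENNReal.ofReal (r / q) *
      ∫⁻ x : ℝ in Set.Icc (-1) 1, ENNReal.ofReal (|x| ^ (-a))) := by
  have hq' : (0 : ℝ) < q := by exact_mod_cast hq
  have h : Measurable ((Set.Icc (-1) 1).indicator (fun x : ℝ => ENNReal.ofReal (|x| ^ (-a)))) :=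
    Measurable.indicator (by fun_prop) measurableSet_Icc
  unfold fracMajorant
  rw [lintegral_const_mul' _ _ ENNReal.ofReal_ne_top]
  congr 1
  have e : ∀ u : ℝ, (u * q - p) / r = (q / r) * u + -(p / r) := fun u => by ring
  simp only [e]
  rw [lintegral_comp_affine (by positivity) _ h, lintegral_indicator measurableSet_Icc,
    abs_of_pos (by positivity), inv_div]

/-- Each u is charged to one Dirichlet fraction p/q, and summing over all admissible fractions
removes the dependence of that choice on u. The peak term stands for p = 0, where `doubleDist`
vanishes and gives no gain. -/
theorem ae_prod_shearSum_le {d : ℕ} (hd : 2 ≤ d) (y : RVec d) {κ : ℝ}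
    (hy : IsDiophantineVec κ y) {σ : ℝ} (hσ0 : 0 < σ) (hσd : σ < d) :
    ∃ K : ℝ, 0 < K ∧ ∀ {r U : ℝ}, 0 < r → r ≤ 1 → 1 ≤ U → ∀ᵐ u : ℝ, u ∈ Set.Icc (-U) U →
      ∏ i, shearSum (d + 4) r (y i) u ≤ ENNReal.ofReal K *
        (ENNReal.ofReal (2 / r ^ d * (1 + (u / r ^ 2) ^ 2)⁻¹) +
          ∑ q ∈ Finset.Icc 1 ⌊1 / r⌋₊, ∑ p ∈ Finset.Icc 1 ⌊2 * U * q⌋₊,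
            ENNReal.ofReal (doubleDist y p ^ (-σ)) *
              (fracMajorant ((d - σ) / 2) r q p u + fracMajorant ((d - σ) / 2) r q (-p) u)) := by
  obtain ⟨K, hK, hmain⟩ := prod_shearSum_le y
  obtain ⟨c, hc, hρ⟩ := hy.le_doubleDist
  refine ⟨K, hK, fun {r U} hr hr1 hU => ?_⟩
  -- At rational u the quantity x may vanish, and `Real.rpow` then makes x^(-a) zero instead of
  -- infinite, so the majorant would fail there.
  have hae : ∀ᵐ u : ℝ, u ∉ Set.range ((↑) : ℚ → ℝ) := (Set.countable_range _).ae_notMem _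
  filter_upwards [hae] with u hu huU
  obtain ⟨p, q, hq, hqN, hpq, happ⟩ := exists_coprime_approx hr hr1 u
  have hq' : (0 : ℝ) < q := by exact_mod_cast hq
  have hrq : r * q ≤ 1 := by
    have : (q : ℝ) ≤ 1 / r := (Nat.cast_le.2 hqN).trans (Nat.floor_le (by positivity))
    rwa [le_div_iff₀' hr] at this
  set x : ℝ := |u * q - p| / r with hx
  have hx1 : x ≤ 1 := by rwa [hx, div_le_one hr]
  set l := max (r * q) x with hl
  have hl1 : l ≤ 1 := max_le hrq hx1
  have hl0 : 0 < l := lt_max_of_lt_left (by positivity)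
  have hx0 : 0 < x := by
    refine div_pos (abs_pos.2 fun h => hu ⟨(p : ℚ) / q, ?_⟩) hr
    push_cast
    rw [div_eq_iff hq'.ne']; linarith
  refine (hmain hr hr1 u hq hpq hl hl1).trans ?_
  rw [ENNReal.ofReal_mul hK.le]
  gcongr
  have hρ0 : 0 ≤ doubleDist y p := norm_nonneg _
  -- If p = 0, coprimality forces q = 1. Then l ≥ r and 2l² ≥ r² + (u/r)², so l^(-d) is below a
  -- Cauchy peak of width r².
  rcases eq_or_ne p 0 with hp0 | hp0
  · refine le_trans (ENNReal.ofReal_le_ofReal ?_) le_self_add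
    have hq1 : q = 1 := by
      rw [hp0, isCoprime_zero_right, Int.isUnit_iff] at hpq; omega
    rw [hq1, hp0] at hx
    simp only [Nat.cast_one, mul_one, Int.cast_zero, sub_zero] at hx
    rw [hq1, Nat.cast_one, mul_one] at hl
    have h1 : ((1 + doubleDist y p / l) ^ d)⁻¹ ≤ 1 :=
      inv_le_one_of_one_le₀ (one_le_pow₀ (by simp only [le_add_iff_nonneg_right]; positivity))
    have hrl : r ≤ l := hl ▸ le_max_left _ _
    have hxl : x ≤ l := hl ▸ le_max_right _ _
    have h2 : (l ^ d)⁻¹ ≤ (r ^ (d - 2))⁻¹ * (l ^ 2)⁻¹ := by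
      rw [← mul_inv]
      refine inv_anti₀ (by positivity) ?_
      calc r ^ (d - 2) * l ^ 2 ≤ l ^ (d - 2) * l ^ 2 := by gcongr
        _ = l ^ d := by rw [← pow_add]; congr 1; omega
    have h3 : (l ^ 2)⁻¹ ≤ 2 / r ^ 2 * (1 + (u / r ^ 2) ^ 2)⁻¹ := by
      rw [← div_eq_mul_inv, div_div, inv_eq_one_div, div_le_div_iff₀ (by positivity) (by positivity)]
      have e : r ^ 2 * (1 + (u / r ^ 2) ^ 2) = r ^ 2 + x ^ 2 := by
        rw [hx, div_pow, div_pow, sq_abs]; field_simp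
      rw [e]
      nlinarith [pow_le_pow_left₀ hr.le hrl 2, pow_le_pow_left₀ hx0.le hxl 2]
    have h4 : (r ^ d : ℝ) = r ^ (d - 2) * r ^ 2 := by rw [← pow_add]; congr 1; omega
    calc (l ^ d)⁻¹ * ((1 + doubleDist y p / l) ^ d)⁻¹ ≤ (l ^ d)⁻¹ * 1 := by gcongr
      _ ≤ (r ^ (d - 2))⁻¹ * (2 / r ^ 2 * (1 + (u / r ^ 2) ^ 2)⁻¹) := by
        rw [mul_one]; exact h2.trans (by gcongr)
      _ = _ := by rw [h4]; field_simp
  · refine le_trans ?_ le_add_self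
    have hn : 0 < p.natAbs := Int.natAbs_pos.2 hp0
    have hqmem : q ∈ Finset.Icc 1 ⌊1 / r⌋₊ := Finset.mem_Icc.2 ⟨hq, hqN⟩
    -- Here |p| ≤ |uq| + |uq-p| ≤ Uq + 1, and 1 ≤ Uq.
    have hpmem : p.natAbs ∈ Finset.Icc 1 ⌊2 * U * q⌋₊ := by
      rw [Finset.mem_Icc, Nat.le_floor_iff (by positivity)]
      refine ⟨hn, ?_⟩
      rw [Nat.cast_natAbs, Int.cast_abs]
      have h1 : |(p : ℝ)| ≤ |u * q| + |u * q - p| := by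
        have := abs_sub (u * q) (u * q - p)
        simpa using this
      have h2 : |u * q| ≤ U * q := by
        rw [abs_mul, abs_of_pos hq']; gcongr; exact abs_le.2 huU
      have h3 : (1 : ℝ) ≤ q := by exact_mod_cast hq
      nlinarith
    have hρn : doubleDist y (p.natAbs : ℤ) = doubleDist y p := by
      rcases Int.natAbs_eq p with h | h
      · rw [← h]
      · conv_rhs => rw [h, doubleDist_neg]
    have hρpos : 0 < doubleDist y p := by
      rw [← hρn]
      exact lt_of_lt_of_le (by have : (0 : ℝ) < p.natAbs := by exact_mod_cast hn
                               positivity) (hρ _ hn)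
    refine le_trans ?_ (Finset.single_le_sum (f := fun q : ℕ => ∑ p ∈ Finset.Icc 1 ⌊2 * U * q⌋₊,
      ENNReal.ofReal (doubleDist y p ^ (-σ)) * (fracMajorant ((d - σ) / 2) r q p u +
        fracMajorant ((d - σ) / 2) r q (-p) u)) (fun _ _ => zero_le) hqmem)
    refine le_trans ?_ (Finset.single_le_sum (f := fun p : ℕ =>
      ENNReal.ofReal (doubleDist y p ^ (-σ)) * (fracMajorant ((d - σ) / 2) r q p u +
        fracMajorant ((d - σ) / 2) r q (-p) u)) (fun _ _ => zero_le) hpmem)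
    have hfm : fracMajorant ((d - σ) / 2) r q p u ≤ fracMajorant ((d - σ) / 2) r q p.natAbs u +
        fracMajorant ((d - σ) / 2) r q (-p.natAbs) u := by
      rcases Int.natAbs_eq p with h | h
      · conv_lhs => rw [h]
        exact le_self_add
      · conv_lhs => rw [h]
        exact le_add_self
    rw [hρn]
    refine le_trans ?_ (mul_le_mul_right hfm _)
    have habs : |(u * q - p) / r| = x := by rw [abs_div, abs_of_pos hr]
    have hmem : (u * q - p) / r ∈ Set.Icc (-1 : ℝ) 1 := abs_le.1 (habs ▸ hx1)
    rw [fracMajorant, Set.indicator_of_mem hmem, habs, ← ENNReal.ofReal_mul (by positivity),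
      ← ENNReal.ofReal_mul (by positivity)]
    refine ENNReal.ofReal_le_ofReal ?_
    -- Only the power σ < d of the decay is used. The remaining l^(-(d-σ)) is split into two equal
    -- halves, one bounded through l ≥ rq and the other through l ≥ x.
    have h1 : ((1 + doubleDist y p / l) ^ d)⁻¹ ≤ (doubleDist y p / l) ^ (-σ) := by
      rw [Real.rpow_neg (by positivity)]
      refine inv_anti₀ (by positivity) ?_
      have : (0 : ℝ) ≤ doubleDist y p / l := by positivity
      calc (doubleDist y p / l) ^ σ ≤ (1 + doubleDist y p / l) ^ σ := by
            gcongr; linarith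
        _ ≤ (1 + doubleDist y p / l) ^ (d : ℝ) :=
            Real.rpow_le_rpow_of_exponent_le (by linarith) hσd.le
        _ = _ := Real.rpow_natCast _ _
    have h2 : (l ^ d)⁻¹ * (doubleDist y p / l) ^ (-σ) =
        doubleDist y p ^ (-σ) * (l ^ (-((d - σ) / 2)) * l ^ (-((d - σ) / 2))) := by
      rw [Real.div_rpow hρ0 hl0.le, ← Real.rpow_add hl0, ← Real.rpow_natCast, ← Real.rpow_neg hl0.le,
        mul_div_assoc', mul_comm (l ^ _), mul_div_assoc, ← Real.rpow_sub hl0]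
      congr 2; ring
    have h3 : l ^ (-((d - σ) / 2)) ≤ (r * q) ^ (-((d - σ) / 2)) :=
      Real.rpow_le_rpow_of_nonpos (by positivity) (le_max_left _ _) (by linarith)
    have h4 : l ^ (-((d - σ) / 2)) ≤ x ^ (-((d - σ) / 2)) :=
      Real.rpow_le_rpow_of_nonpos hx0 (le_max_right _ _) (by linarith)
    calc (l ^ d)⁻¹ * ((1 + doubleDist y p / l) ^ d)⁻¹
        ≤ (l ^ d)⁻¹ * (doubleDist y p / l) ^ (-σ) := by gcongr
      _ ≤ _ := by rw [h2]; gcongr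

/-- With a = (d-σ)/2, the fractions of denominator q have total mass at most a multiple of Uq ·
(rq)^(-a) · r/q, where Uq bounds the sum of ρ(p)^(-σ) over p up to 2Uq. Summation over q ≤ 1/r gives
O(U), the order of the length of the interval. -/
theorem lintegral_prod_shearSum_le {d : ℕ} (hd : 2 ≤ d) (y : RVec d) {κ : ℝ}
    (hκ : κ * ((d : ℝ) - 2) < (d : ℝ) - 1) (hy : IsDiophantineVec κ y) {R : ℝ} (hR : 1 ≤ R) :
    ∃ C : ℝ, 0 ≤ C ∧ ∀ r : ℝ, 0 < r → r ≤ 1 →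
      ∫⁻ u in Set.Icc (-(R / r ^ (d - 2))) (R / r ^ (d - 2)), ∏ i, shearSum (d + 4) r (y i) u
        ≤ ENNReal.ofReal (C / r ^ (d - 2)) := by
  have hd' : (2 : ℝ) ≤ d := by exact_mod_cast hd
  -- we may assume `1 < κ`
  obtain ⟨κ, hκ1, hκ, hy⟩ : ∃ κ : ℝ, 1 < κ ∧ κ * ((d : ℝ) - 2) < (d : ℝ) - 1 ∧
      IsDiophantineVec κ y := by
    refine ⟨max κ (1 + 1 / d), lt_max_of_lt_right (by simp; omega), ?_, hy.mono (le_max_left _ _)⟩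
    rcases max_cases κ (1 + 1 / (d : ℝ)) with h | h
    · rw [h.1]; exact hκ
    · rw [h.1]
      have : (1 + 1 / (d : ℝ)) * (d - 2) = d - 1 - 2 / d := by field_simp; ring
      rw [this]
      have : (0 : ℝ) < 2 / d := by positivity
      linarith
  have hν : 0 < κ - 1 := by linarith
  -- σ > d-2 makes a < 1, so that |x|^(-a) is integrable at 0; σ < d makes a > 0; σ < 1/(κ-1)
  -- controls the sum over p.
  have hlt : (d : ℝ) - 2 < min (d : ℝ) (1 / (κ - 1)) := by
    rw [lt_min_iff, lt_div_iff₀ hν]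
    constructor <;> nlinarith
  obtain ⟨σ, hσ1, hσ2⟩ := exists_between hlt
  rw [lt_min_iff] at hσ2
  have hσ0 : 0 < σ := by linarith
  obtain ⟨K, hK, hae⟩ := ae_prod_shearSum_le hd y hy hσ0 hσ2.1
  obtain ⟨c, hc, hρ⟩ := hy.le_doubleDist
  obtain ⟨D, hD, hsum⟩ := exists_sum_rpow_neg_le (fun p : ℕ => doubleDist y p) hc hν hσ0.le hσ2.2
    (fun p hp => hρ p hp) (fun p => doubleDist_le_one y p)
    (fun p p' h => by simpa [Nat.cast_sub h.le] using doubleDist_sub_le y p p')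
  set a : ℝ := (d - σ) / 2 with ha
  have ha0 : 0 < a := by rw [ha]; linarith [hσ2.1]
  have ha1 : a < 1 := by rw [ha]; linarith
  set I : ℝ := (∫⁻ x : ℝ in Set.Icc (-1) 1, ENNReal.ofReal (|x| ^ (-a))).toReal with hI
  have hIe : ∫⁻ x : ℝ in Set.Icc (-1) 1, ENNReal.ofReal (|x| ^ (-a)) = ENNReal.ofReal I :=
    (ENNReal.ofReal_toReal (lintegral_unit_rpow_lt_top ha1).ne).symm
  have hI0 : 0 ≤ I := ENNReal.toReal_nonneg
  have h1a : 0 < 1 - a := by linarith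
  refine ⟨K * (2 * Real.pi + 4 * I * D * R / (1 - a)), by positivity, fun r hr hr1 => ?_⟩
  set U := R / r ^ (d - 2) with hU
  have hU1 : 1 ≤ U := by
    rw [hU, le_div_iff₀ (by positivity), one_mul]
    exact (pow_le_one₀ hr.le hr1).trans hR
  have hU0 : 0 < U := by linarith
  set N := ⌊1 / r⌋₊ with hN
  have hrN : r * N ≤ 1 := by
    have : (N : ℝ) ≤ 1 / r := Nat.floor_le (by positivity)
    rwa [le_div_iff₀' hr] at this
  -- Rescaling u by r² turns the peak into 2r^(2-d) times the Cauchy integral π.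
  have hpeak : ∫⁻ u : ℝ, ENNReal.ofReal (2 / r ^ d * (1 + (u / r ^ 2) ^ 2)⁻¹) =
      ENNReal.ofReal (2 * Real.pi / r ^ (d - 2)) := by
    have hm : Measurable fun x : ℝ => ENNReal.ofReal (2 / r ^ d * (1 + x ^ 2)⁻¹) := by fun_prop
    have e : ∀ u : ℝ, u / r ^ 2 = (r ^ 2)⁻¹ * u + 0 := fun u => by ring
    simp only [e]
    rw [lintegral_comp_affine (by positivity) 0 hm, inv_inv, abs_of_pos (by positivity),
      ← ofReal_integral_eq_lintegral_ofReal (integrable_inv_one_add_sq.const_mul _)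
        (ae_of_all _ fun x => by positivity), integral_const_mul, integral_univ_inv_one_add_sq,
      ← ENNReal.ofReal_mul (by positivity)]
    congr 1
    have h4 : (r ^ d : ℝ) = r ^ (d - 2) * r ^ 2 := by rw [← pow_add]; congr 1; omega
    rw [h4]; field_simp
  have hq : ∀ q ∈ Finset.Icc 1 N, ∑ p ∈ Finset.Icc 1 ⌊2 * U * q⌋₊,
      ENNReal.ofReal (doubleDist y p ^ (-σ)) * (ENNReal.ofReal ((r * q) ^ (-a)) *
        (ENNReal.ofReal (r / q) * ENNReal.ofReal I) + ENNReal.ofReal ((r * q) ^ (-a)) *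
        (ENNReal.ofReal (r / q) * ENNReal.ofReal I)) ≤
      ENNReal.ofReal (4 * I * D * U * r ^ (1 - a) * (q : ℝ) ^ (-a)) := by
    intro q hq
    have hq' : (0 : ℝ) < q := by exact_mod_cast (Finset.mem_Icc.1 hq).1
    rw [← Finset.sum_mul]
    refine (mul_le_mul_left (hsum (2 * U * q) (by positivity)) _).trans_eq ?_
    rw [← ENNReal.ofReal_mul (by positivity), ← ENNReal.ofReal_mul (by positivity),
      ← ENNReal.ofReal_add (by positivity) (by positivity), ← ENNReal.ofReal_mul (by positivity)]
    congr 1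
    rw [Real.mul_rpow hr.le hq'.le, sub_eq_add_neg, Real.rpow_add hr, Real.rpow_one]
    field_simp; ring
  calc ∫⁻ u in Set.Icc (-U) U, ∏ i, shearSum (d + 4) r (y i) u
      ≤ ∫⁻ u in Set.Icc (-U) U, ENNReal.ofReal K *
        (ENNReal.ofReal (2 / r ^ d * (1 + (u / r ^ 2) ^ 2)⁻¹) +
          ∑ q ∈ Finset.Icc 1 N, ∑ p ∈ Finset.Icc 1 ⌊2 * U * q⌋₊,
            ENNReal.ofReal (doubleDist y p ^ (-σ)) *
              (fracMajorant a r q p u + fracMajorant a r q (-p) u)) :=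
        lintegral_mono_ae ((ae_restrict_iff' measurableSet_Icc).2 (hae hr hr1 hU1))
    _ ≤ ∫⁻ u, ENNReal.ofReal K *
        (ENNReal.ofReal (2 / r ^ d * (1 + (u / r ^ 2) ^ 2)⁻¹) +
          ∑ q ∈ Finset.Icc 1 N, ∑ p ∈ Finset.Icc 1 ⌊2 * U * q⌋₊,
            ENNReal.ofReal (doubleDist y p ^ (-σ)) *
              (fracMajorant a r q p u + fracMajorant a r q (-p) u)) :=
        setLIntegral_le_lintegral _ _
    _ = ENNReal.ofReal K * (ENNReal.ofReal (2 * Real.pi / r ^ (d - 2)) +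
          ∑ q ∈ Finset.Icc 1 N, ∑ p ∈ Finset.Icc 1 ⌊2 * U * q⌋₊,
            ENNReal.ofReal (doubleDist y p ^ (-σ)) *
              (ENNReal.ofReal ((r * q) ^ (-a)) * (ENNReal.ofReal (r / q) * ENNReal.ofReal I) +
               ENNReal.ofReal ((r * q) ^ (-a)) * (ENNReal.ofReal (r / q) * ENNReal.ofReal I))) := by
        have hm := measurable_fracMajorant a r
        rw [lintegral_const_mul' _ _ ENNReal.ofReal_ne_top, lintegral_add_left (by fun_prop), hpeak,
          lintegral_finsetSum _ (fun q _ => by fun_prop)]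
        congr 2
        refine Finset.sum_congr rfl fun q hq => ?_
        rw [lintegral_finsetSum _ (fun q _ => by fun_prop)]
        refine Finset.sum_congr rfl fun p _ => ?_
        have hq0 : 0 < q := (Finset.mem_Icc.1 hq).1
        rw [lintegral_const_mul' _ _ ENNReal.ofReal_ne_top, lintegral_add_left (hm q p),
          lintegral_fracMajorant a hr hq0, lintegral_fracMajorant a hr hq0, hIe]
    _ ≤ ENNReal.ofReal K * (ENNReal.ofReal (2 * Real.pi / r ^ (d - 2)) +
          ∑ q ∈ Finset.Icc 1 N, ENNReal.ofReal (4 * I * D * U * r ^ (1 - a) * (q : ℝ) ^ (-a))) := by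
        gcongr with q hq'; exact hq q hq'
    _ ≤ ENNReal.ofReal K * (ENNReal.ofReal (2 * Real.pi / r ^ (d - 2)) +
          ENNReal.ofReal (4 * I * D * U / (1 - a))) := by
        gcongr
        rw [← ENNReal.ofReal_sum_of_nonneg (fun i _ => by positivity), ← Finset.mul_sum]
        refine ENNReal.ofReal_le_ofReal ?_
        have h5 : r ^ (1 - a) * (N : ℝ) ^ (1 - a) ≤ 1 := by
          rw [← Real.mul_rpow hr.le (Nat.cast_nonneg _)]
          exact Real.rpow_le_one (by positivity) hrN h1a.le
        calc _ ≤ 4 * I * D * U * r ^ (1 - a) * ((N : ℝ) ^ (1 - a) / (1 - a)) := by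
              gcongr; exact sum_rpow_neg_le ha0.le ha1 N
          _ = 4 * I * D * U / (1 - a) * (r ^ (1 - a) * (N : ℝ) ^ (1 - a)) := by ring
          _ ≤ 4 * I * D * U / (1 - a) * 1 := by gcongr
          _ = _ := mul_one _
    _ = _ := by
        rw [← ENNReal.ofReal_add (by positivity) (by positivity), ← ENNReal.ofReal_mul hK.le]
        congr 1
        rw [hU]; ring

/-! ### Oscillatory sums over lattices -/

theorem expTwoPiI_add (s t : ℝ) : expTwoPiI (s + t) = expTwoPiI s * expTwoPiI t := by
  simp only [expTwoPiI]
  rw [← Complex.exp_add]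
  push_cast
  congr 1; ring

theorem norm_expTwoPiI (s : ℝ) : ‖expTwoPiI s‖ = 1 := by
  have : 2 * (Real.pi : ℂ) * Complex.I * (s : ℂ) = ((2 * Real.pi * s : ℝ) : ℂ) * Complex.I := by
    push_cast; ring
  rw [expTwoPiI, this, Complex.norm_exp_ofReal_mul_I]

theorem expTwoPiI_intCast (n : ℤ) : expTwoPiI n = 1 := by
  have : 2 * (Real.pi : ℂ) * Complex.I * ((n : ℝ) : ℂ) = n * (2 * Real.pi * Complex.I) := by
    push_cast; ring
  rw [expTwoPiI, this, Complex.exp_int_mul_two_pi_mul_I]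

theorem continuous_expTwoPiI : Continuous expTwoPiI := by
  unfold expTwoPiI; fun_prop

/-- |1 - e(s)| = 2|sin πs|, and Jordan's inequality bounds the sine below by a chord. -/
theorem four_mul_circleNorm_le (s : ℝ) : 4 * circleNorm s ≤ ‖1 - expTwoPiI s‖ := by
  set t := s - round s with ht
  have h1 : expTwoPiI s = expTwoPiI t := by
    have : s = t + round s := by simp [ht]
    rw [this, expTwoPiI_add, expTwoPiI_intCast, mul_one]
  have h2 : circleNorm s = |t| := by rw [circleNorm, UnitAddCircle.norm_eq]
  have h3 : |t| ≤ 1 / 2 := abs_sub_round s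
  have h4 : expTwoPiI t = Complex.exp (Complex.I * (2 * Real.pi * t : ℝ)) := by
    rw [expTwoPiI]; congr 1; push_cast; ring
  rw [h1, h2, norm_sub_rev, h4, Complex.norm_exp_I_mul_ofReal_sub_one, norm_mul, Real.norm_eq_abs,
    Real.norm_eq_abs, abs_two, show 2 * Real.pi * t / 2 = Real.pi * t by ring]
  have h5 : |Real.sin (Real.pi * t)| = Real.sin (Real.pi * |t|) := by
    rcases le_total 0 t with h | h
    · rw [abs_of_nonneg h, abs_of_nonneg]
      rw [abs_of_nonneg h] at h3
      exact Real.sin_nonneg_of_nonneg_of_le_pi (by positivity) (by nlinarith [Real.pi_pos])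
    · rw [abs_of_nonpos h, mul_neg, Real.sin_neg, abs_of_nonpos]
      rw [abs_of_nonpos h] at h3
      exact Real.sin_nonpos_of_nonpos_of_neg_pi_le (by nlinarith [Real.pi_pos])
        (by nlinarith [Real.pi_pos])
  have h6 := Real.mul_le_sin (x := Real.pi * |t|) (by positivity) (by nlinarith [Real.pi_pos])
  rw [h5]
  have : 2 / Real.pi * (Real.pi * |t|) = 2 * |t| := by field_simp
  linarith

/-- The derivatives of `g` up to the order `m` are at most `B (1 + ‖x‖)^{-T}`. -/
structure DerivDecay {E : Type*} [NormedAddCommGroup E] [NormedSpace ℝ E] (T m : ℕ) (B : ℝ)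
    (g : E → ℂ) : Prop where
  smooth : ContDiff ℝ ((⊤ : ℕ∞) : WithTop ℕ∞) g
  bound : ∀ l ≤ m, ∀ x, (1 + ‖x‖) ^ T * ‖iteratedFDeriv ℝ l g x‖ ≤ B

section

variable {E : Type*} [NormedAddCommGroup E] [NormedSpace ℝ E]

theorem DerivDecay.norm_le {T m : ℕ} {B : ℝ} {g : E → ℂ} (hg : DerivDecay T m B g) (x : E) :
    ‖g x‖ ≤ B * ((1 + ‖x‖) ^ T)⁻¹ := by
  have := hg.bound 0 (Nat.zero_le _) x
  rw [norm_iteratedFDeriv_zero] at this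
  rw [← div_eq_mul_inv, le_div_iff₀' (by positivity)]
  exact this

theorem DerivDecay.nonneg {T m : ℕ} {B : ℝ} {g : E → ℂ} (hg : DerivDecay T m B g) : 0 ≤ B :=
  le_trans (by positivity) (hg.bound 0 (Nat.zero_le _) 0)

/-- The mean value inequality trades one derivative for a factor r. Since r ≤ 1, the weight 1 + ‖·‖
varies by a factor of at most 2 over the ball used, whence 2^T. -/
theorem DerivDecay.sub_shift {T m : ℕ} {B r : ℝ} {g : E → ℂ} (hg : DerivDecay T (m + 1) B g)
    {h : E} (hh : ‖h‖ ≤ r) (hr1 : r ≤ 1) :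
    DerivDecay T m (B * (2 ^ T * r)) (fun x => g x - g (x - h)) := by
  have hB := hg.nonneg
  have hs : ContDiff ℝ ((⊤ : ℕ∞) : WithTop ℕ∞) (fun x => g (x - h)) :=
    hg.smooth.comp (contDiff_id.sub contDiff_const)
  refine ⟨hg.smooth.sub hs, fun l hl x => ?_⟩
  have hlt : ∀ n : ℕ, (n : WithTop ℕ∞) ≤ ((⊤ : ℕ∞) : WithTop ℕ∞) := fun n => by
    exact_mod_cast le_top
  have e : iteratedFDeriv ℝ l (fun x => g x - g (x - h)) x =
      iteratedFDeriv ℝ l g x - iteratedFDeriv ℝ l g (x - h) := by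
    rw [← iteratedFDeriv_comp_sub, ← Pi.sub_def]
    exact iteratedFDeriv_sub_apply (hg.smooth.of_le (hlt l)).contDiffAt (hs.of_le (hlt l)).contDiffAt
  have hd : Differentiable ℝ (iteratedFDeriv ℝ l g) :=
    hg.smooth.differentiable_iteratedFDeriv (by exact_mod_cast ENat.natCast_lt_top l)
  have hmv := (convex_closedBall x ‖h‖).norm_image_sub_le_of_norm_fderiv_le (𝕜 := ℝ)
    (f := iteratedFDeriv ℝ l g) (C := B * 2 ^ T * ((1 + ‖x‖) ^ T)⁻¹) (x := x - h) (y := x)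
    (fun z _ => hd z) (fun z hz => ?_) (by simp) (by simp)
  · rw [e]
    rw [sub_sub_cancel] at hmv
    calc _ ≤ (1 + ‖x‖) ^ T * (B * 2 ^ T * ((1 + ‖x‖) ^ T)⁻¹ * r) := by
          gcongr; exact hmv.trans (by gcongr)
      _ = _ := by field_simp
  · rw [norm_fderiv_iteratedFDeriv, ← div_eq_mul_inv, le_div_iff₀ (by positivity)]
    have h1 := hg.bound (l + 1) (by omega) z
    have h2 : 1 + ‖x‖ ≤ 2 * (1 + ‖z‖) := by
      have h3 : ‖z - x‖ ≤ 1 := (mem_closedBall_iff_norm.1 hz).trans (hh.trans hr1)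
      have h4 : ‖x‖ ≤ ‖z‖ + ‖z - x‖ := by
        have := norm_sub_le z (z - x); rwa [sub_sub_cancel] at this
      have := norm_nonneg z
      linarith
    calc ‖iteratedFDeriv ℝ (l + 1) g z‖ * (1 + ‖x‖) ^ T
        ≤ ‖iteratedFDeriv ℝ (l + 1) g z‖ * (2 * (1 + ‖z‖)) ^ T := by gcongr
      _ = 2 ^ T * ((1 + ‖z‖) ^ T * ‖iteratedFDeriv ℝ (l + 1) g z‖) := by rw [mul_pow]; ring
      _ ≤ 2 ^ T * B := by gcongr
      _ = _ := mul_comm _ _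

variable {ι : Type*} [Fintype ι]

/-- The point `x + ∑ c_i h_i` of an affine lattice. -/
def latticePoint (x : E) (h : ι → E) (c : ι → ℤ) : E := x + ∑ i, (c i : ℝ) • h i

/-- The sum of `g(x + ∑ c_i h_i) e(∑ s_i c_i)` over `c ∈ ℤ^ι`. -/
noncomputable def oscSum (g : E → ℂ) (x : E) (h : ι → E) (s : ι → ℝ) : ℂ :=
  ∑' c : ι → ℤ, g (latticePoint x h c) * expTwoPiI (∑ i, s i * c i)

theorem DerivDecay.summable_osc {T m : ℕ} {B : ℝ} {g : E → ℂ} (hg : DerivDecay T m B g) {x : E}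
    {h : ι → E} (hW : Summable fun c : ι → ℤ => ((1 + ‖latticePoint x h c‖) ^ T)⁻¹) (s : ι → ℝ) :
    Summable fun c : ι → ℤ => g (latticePoint x h c) * expTwoPiI (∑ i, s i * c i) := by
  refine Summable.of_norm_bounded (hW.mul_left B) fun c => ?_
  rw [norm_mul, norm_expTwoPiI, mul_one]
  exact hg.norm_le _

/-- Summation by parts: translating the index by a unit vector multiplies the character by a
constant and shifts g by `h i`. -/
theorem one_sub_mul_oscSum [DecidableEq ι] {g : E → ℂ} {x : E} {h : ι → E} {s : ι → ℝ}
    (hs : Summable fun c : ι → ℤ => g (latticePoint x h c) * expTwoPiI (∑ i, s i * c i)) (i : ι) :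
    (1 - expTwoPiI (s i)) * oscSum g x h s = oscSum (fun z => g z - g (z - h i)) x h s := by
  have e : ∀ c : ι → ℤ, expTwoPiI (s i) *
      (g (latticePoint x h (c - Pi.single i 1)) *
        expTwoPiI (∑ j, s j * ((c - Pi.single i 1 : ι → ℤ) j : ℝ))) =
      g (latticePoint x h c - h i) * expTwoPiI (∑ j, s j * c j) := by
    intro c
    have e1 : latticePoint x h (c - Pi.single i 1) = latticePoint x h c - h i := by
      simp only [latticePoint, Pi.sub_apply, Int.cast_sub, sub_smul, Finset.sum_sub_distrib]
      rw [add_sub_assoc]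
      congr 2
      rw [Finset.sum_eq_single i (fun j _ hj => by simp [hj]) (by simp)]
      simp
    have e2 : ∑ j, s j * ((c - Pi.single i 1 : ι → ℤ) j : ℝ) = (∑ j, s j * c j) + -s i := by
      simp only [Pi.sub_apply, Int.cast_sub, mul_sub, Finset.sum_sub_distrib]
      rw [sub_eq_add_neg]
      congr 2
      rw [Finset.sum_eq_single i (fun j _ hj => by simp [hj]) (by simp)]
      simp
    have e3 : expTwoPiI (s i) * expTwoPiI (-s i) = 1 := by
      rw [← expTwoPiI_add, add_neg_cancel]; simpa using expTwoPiI_intCast 0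
    rw [e1, e2, expTwoPiI_add]
    linear_combination g (latticePoint x h c - h i) * expTwoPiI (∑ j, s j * c j) * e3
  have hs' : Summable fun c : ι → ℤ =>
      g (latticePoint x h c - h i) * expTwoPiI (∑ j, s j * c j) := by
    have := (((Equiv.subRight (Pi.single i 1 : ι → ℤ)).summable_iff).2 hs).mul_left (expTwoPiI (s i))
    exact this.congr fun c => e c
  rw [sub_mul, one_mul]
  simp only [oscSum, sub_mul]
  rw [Summable.tsum_sub hs hs']
  congr 1
  rw [← (Equiv.subRight (Pi.single i 1 : ι → ℤ)).tsum_eq, ← tsum_mul_left]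
  exact tsum_congr e

/-- Summation by parts is repeated along a list of directions, each step gaining 2^T r. A list
allows the same direction to be used several times. -/
theorem DerivDecay.list_prod_mul_norm_oscSum_le {T : ℕ} {r : ℝ} (hr1 : r ≤ 1) {x : E}
    {h : ι → E} (hh : ∀ i, ‖h i‖ ≤ r)
    (hW : Summable fun c : ι → ℤ => ((1 + ‖latticePoint x h c‖) ^ T)⁻¹) (s : ι → ℝ)
    (l : List ι) {m : ℕ} {B : ℝ} {g : E → ℂ} (hm : l.length ≤ m) (hg : DerivDecay T m B g) :
    (l.map fun i => ‖1 - expTwoPiI (s i)‖).prod * ‖oscSum g x h s‖ ≤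
      B * (2 ^ T * r) ^ l.length * ∑' c : ι → ℤ, ((1 + ‖latticePoint x h c‖) ^ T)⁻¹ := by
  classical
  induction l generalizing m B g with
  | nil =>
    simp only [List.map_nil, List.prod_nil, one_mul, List.length_nil, pow_zero, mul_one]
    rw [← tsum_mul_left]
    refine tsum_of_norm_bounded (hW.mul_left B).hasSum fun c => ?_
    rw [norm_mul, norm_expTwoPiI, mul_one]
    exact hg.norm_le _
  | cons i l ih =>
    obtain ⟨m, rfl⟩ : ∃ k, m = k + 1 := ⟨m - 1, by rw [List.length_cons] at hm; omega⟩
    have h1 := ih (by simpa using hm) (hg.sub_shift (hh i) hr1)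
    rw [← one_sub_mul_oscSum (hg.summable_osc hW s) i, norm_mul] at h1
    rw [List.map_cons, List.prod_cons, List.length_cons, pow_succ]
    calc _ = _ := by ring
      _ ≤ _ := h1
      _ = _ := by ring

/-- Differences are taken A times in each direction with ‖s_i‖ ≥ r. In the other directions 1 +
‖s_i‖/r is at most 2, so nothing has to be gained. -/
theorem DerivDecay.norm_oscSum_le {T A : ℕ} {r : ℝ} (hr : 0 < r) (hr1 : r ≤ 1) {x : E}
    {h : ι → E} (hh : ∀ i, ‖h i‖ ≤ r)
    (hW : Summable fun c : ι → ℤ => ((1 + ‖latticePoint x h c‖) ^ T)⁻¹) (s : ι → ℝ)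
    {B : ℝ} {g : E → ℂ} (hg : DerivDecay T (A * Fintype.card ι) B g) :
    ‖oscSum g x h s‖ ≤ B * (2 ^ (T + 1)) ^ (A * Fintype.card ι) *
      (∑' c : ι → ℤ, ((1 + ‖latticePoint x h c‖) ^ T)⁻¹) *
      ∏ i, ((1 + circleNorm (s i) / r) ^ A)⁻¹ := by
  classical
  have hB := hg.nonneg
  set W := ∑' c : ι → ℤ, ((1 + ‖latticePoint x h c‖) ^ T)⁻¹ with hWdef
  have hW0 : 0 ≤ W := tsum_nonneg fun c => by positivity
  have hc0 : ∀ i, 0 ≤ circleNorm (s i) := fun i => norm_nonneg _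
  set S : Finset ι := Finset.univ.filter fun i => r ≤ circleNorm (s i) with hS
  set l : List ι := (List.replicate A S.toList).flatten with hl
  have hlen : l.length = A * S.card := by
    simp [hl, List.length_flatten]
  have hScard : S.card ≤ Fintype.card ι := Finset.card_le_univ S
  have hprod : ∀ f : ι → ℝ, (l.map f).prod = (∏ i ∈ S, f i) ^ A := by
    intro f
    rw [hl, List.map_flatten, List.prod_flatten, List.map_replicate, List.map_replicate,
      List.prod_replicate, Finset.prod_map_toList]
  have h1 := DerivDecay.list_prod_mul_norm_oscSum_le hr1 hh hW s l
    (hlen ▸ Nat.mul_le_mul_left A hScard) hg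
  rw [hprod, hlen] at h1
  -- On S one has r(1 + ‖s_i‖/r) = r + ‖s_i‖ ≤ 2‖s_i‖ ≤ |1 - e(s_i)|.
  have h2 : r ^ S.card * ∏ i ∈ S, (1 + circleNorm (s i) / r) ≤
      ∏ i ∈ S, ‖1 - expTwoPiI (s i)‖ := by
    rw [← Finset.prod_const, ← Finset.prod_mul_distrib]
    refine Finset.prod_le_prod (fun i _ => by have := hc0 i; positivity) fun i hi => ?_
    have h3 : r ≤ circleNorm (s i) := (Finset.mem_filter.1 hi).2
    rw [mul_add, mul_div_cancel₀ _ hr.ne']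
    linarith [four_mul_circleNorm_le (s i)]
  have h4 : (∏ i ∈ S, (1 + circleNorm (s i) / r)) ^ A * ‖oscSum g x h s‖ ≤
      B * (2 ^ T) ^ (A * S.card) * W := by
    have hpos : 0 < r ^ (A * S.card) := by positivity
    refine le_of_mul_le_mul_left ?_ hpos
    have hp0 : 0 ≤ ∏ i ∈ S, (1 + circleNorm (s i) / r) :=
      Finset.prod_nonneg fun i _ => by have := hc0 i; positivity
    calc _ = (r ^ S.card * ∏ i ∈ S, (1 + circleNorm (s i) / r)) ^ A * ‖oscSum g x h s‖ := by
          rw [mul_pow, ← pow_mul, mul_comm A]; ring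
      _ ≤ (∏ i ∈ S, ‖1 - expTwoPiI (s i)‖) ^ A * ‖oscSum g x h s‖ := by gcongr
      _ ≤ _ := h1
      _ = _ := by rw [mul_pow]; ring
  have h5 : ∏ i ∈ Sᶜ, (1 + circleNorm (s i) / r) ≤ 2 ^ Sᶜ.card := by
    rw [← Finset.prod_const]
    refine Finset.prod_le_prod (fun i _ => by have := hc0 i; positivity) fun i hi => ?_
    have h3 : circleNorm (s i) < r := by simpa [hS] using hi
    have : circleNorm (s i) / r ≤ 1 := (div_le_one hr).2 h3.le
    linarith
  have hpall : 0 < ∏ i, (1 + circleNorm (s i) / r) :=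
    Finset.prod_pos fun i _ => by have := hc0 i; positivity
  rw [Finset.prod_inv_distrib, ← div_eq_mul_inv, Finset.prod_pow, le_div_iff₀' (by positivity),
    ← Finset.prod_mul_prod_compl S, mul_pow]
  calc _ = (∏ i ∈ Sᶜ, (1 + circleNorm (s i) / r)) ^ A *
        ((∏ i ∈ S, (1 + circleNorm (s i) / r)) ^ A * ‖oscSum g x h s‖) := by ring
    _ ≤ (2 ^ Sᶜ.card) ^ A * (B * (2 ^ T) ^ (A * S.card) * W) := by
        have : 0 ≤ ∏ i ∈ Sᶜ, (1 + circleNorm (s i) / r) :=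
          Finset.prod_nonneg fun i _ => by have := hc0 i; positivity
        gcongr
    _ ≤ (2 ^ Fintype.card ι) ^ A * (B * (2 ^ T) ^ (A * Fintype.card ι) * W) := by
        have h6 : Sᶜ.card ≤ Fintype.card ι := Finset.card_le_univ _
        gcongr
        · norm_num
        · exact one_le_pow₀ (by norm_num)
    _ = _ := by rw [pow_succ, mul_pow, ← pow_mul 2 (Fintype.card ι), mul_comm A]; ring

end

/-! ### Theta functions at the points of a horocycle -/

theorem horoPoint_lin {d k : ℕ} {r : ℝ} (hr : 0 < r) (Y : RMat d k) (u : Fin k → ℝ) (j : Fin k) :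
    (horoPoint r Y u j).lin.1 = !![r, u j / r; 0, 1 / r] := by
  have h1 : Real.exp (-(-Real.log (r ^ 2)) / 2) = r := by
    rw [Real.log_pow, neg_neg]; push_cast
    rw [mul_div_cancel_left₀ _ (two_ne_zero), Real.exp_log hr]
  have h2 : Real.exp (-Real.log (r ^ 2) / 2) = 1 / r := by
    rw [neg_div, Real.exp_neg, Real.log_pow]; push_cast
    rw [mul_div_cancel_left₀ _ (two_ne_zero), Real.exp_log hr, one_div]
  change !![1, u j; 0, 1] * !![Real.exp (-(-Real.log (r ^ 2)) / 2), 0; 0,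
    Real.exp (-Real.log (r ^ 2) / 2)] * !![Real.cos 0, -Real.sin 0; Real.sin 0, Real.cos 0] = _
  rw [h1, h2]
  ext a b
  fin_cases a <;> fin_cases b <;> simp [Matrix.mul_apply, div_eq_mul_inv]

theorem horoPoint_mul_lin {d k : ℕ} (r : ℝ) (Y : RMat d k) (u : Fin k → ℝ) (z : RVec d) (j : Fin k) :
    ((horoPoint r Y u * zShift k z) j).lin = (horoPoint r Y u j).lin :=
  mul_one (horoPoint r Y u j).lin

theorem horoPoint_mul_x {d k : ℕ} {r : ℝ} (hr : 0 < r) (Y : RMat d k) (u : Fin k → ℝ)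
    (z : RVec d) (j : Fin k) :
    ((horoPoint r Y u * zShift k z) j).x = (u j / (2 * r)) • z := by
  change (0 : RVec d) + ((horoPoint r Y u j).lin.1 0 0 • (0 : RVec d) +
    (horoPoint r Y u j).lin.1 0 1 • ((1 / 2 : ℝ) • z)) = _
  rw [horoPoint_lin hr]
  simp [smul_smul]
  congr 1; field_simp

theorem horoPoint_mul_y {d k : ℕ} {r : ℝ} (hr : 0 < r) (Y : RMat d k) (u : Fin k → ℝ)
    (z : RVec d) (j : Fin k) :
    ((horoPoint r Y u * zShift k z) j).y = Y j + (1 / (2 * r)) • z := by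
  change Y j + ((horoPoint r Y u j).lin.1 1 0 • (0 : RVec d) +
    (horoPoint r Y u j).lin.1 1 1 • ((1 / 2 : ℝ) • z)) = _
  rw [horoPoint_lin hr]
  simp [smul_smul]

theorem iwasawaTau_horoPoint {d k : ℕ} {r : ℝ} (hr : 0 < r) (Y : RMat d k) (u : Fin k → ℝ)
    (j : Fin k) : iwasawaTau (horoPoint r Y u j).lin = ⟨⟨u j, r ^ 2⟩, pow_pos hr 2⟩ := by
  have h : (horoPoint r Y u j).lin =
      UpperHalfPlane.toSL2R ⟨⟨u j, r ^ 2⟩, pow_pos hr 2⟩ := by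
    apply Subtype.ext
    rw [horoPoint_lin hr, UpperHalfPlane.coe_toSL2R]
    simp [UpperHalfPlane.im, UpperHalfPlane.re, Real.sqrt_sq hr.le]
  rw [iwasawaTau, h, UpperHalfPlane.toSL2R_smul_I]

theorem iwasawaPhi_horoPoint {d k : ℕ} {r : ℝ} (hr : 0 < r) (Y : RMat d k) (u : Fin k → ℝ)
    (j : Fin k) : iwasawaPhi (horoPoint r Y u j).lin = 0 := by
  rw [iwasawaPhi, horoPoint_lin hr]
  have : Complex.arg ⟨1 / r, 0⟩ = 0 := by
    have : (⟨1 / r, 0⟩ : ℂ) = ((1 / r : ℝ) : ℂ) := rfl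
    rw [this, Complex.arg_ofReal_of_nonneg (by positivity)]
  simp only [Matrix.of_apply, Matrix.cons_val', Matrix.cons_val_zero, Matrix.cons_val_one,
    Matrix.cons_val_fin_one, this]
  rw [toIcoMod_eq_self]
  simp [Real.pi_pos]

/-- No column is integrated, so the transform is an integral over a one-point space of mass one. -/
theorem rotTransform_zero {d k : ℕ} (f : RMat d k → RMat d k → ℂ) (Y Y' : RMat d k) :
    rotTransform f (fun _ => 0) Y Y' = f Y Y' := by
  unfold rotTransform
  have : IsEmpty {j : Fin k // Real.sin ((fun _ => (0 : ℝ)) j) ≠ 0} := ⟨fun j => j.2 (by simp)⟩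
  have hmix : ∀ (X : RMat d k) (Z : {j : Fin k // Real.sin ((fun _ => (0 : ℝ)) j) ≠ 0} → RVec d),
      mixColumns (fun _ => 0) X Z = X := fun X Z => by
    funext j; simp [mixColumns]
  simp only [hmix, Finset.univ_eq_empty, Finset.prod_empty, one_mul]
  have hvol : (volume : Measure (({j : Fin k // Real.sin ((fun _ => (0 : ℝ)) j) ≠ 0} → RVec d) ×
      ({j : Fin k // Real.sin ((fun _ => (0 : ℝ)) j) ≠ 0} → RVec d))).real Set.univ = 1 := by
    rw [Measure.volume_eq_prod, ← Set.univ_prod_univ, measureReal_prod_prod, volume_pi,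
      Measure.pi_of_empty]
    simp
  rw [integral_const, hvol, one_smul]

/-- Right translation moves y by δ = r^(d-1)η/2 and x by u_j δ. The quadratic phase then changes by
-u_j δ·(m-m'), which the character x·(m-m') cancels: η survives only in the argument of f. -/
theorem thetaTerm_horoPoint {d k : ℕ} {r : ℝ} (hr : 0 < r) (f : RMat d k → RMat d k → ℂ)
    (Y : RMat d k) (u : Fin k → ℝ) (η : RVec d)
    (M : (Fin k → Fin d → ℤ) × (Fin k → Fin d → ℤ)) :
    thetaTerm f (horoPoint r Y u * zShift k (r ^ d • η)) M =
      ((r ^ (d * k) : ℝ) : ℂ) * (f (fun j => r • (intVec (M.1 j) - Y j) - (r ^ d / 2) • η)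
        (fun j => r • (intVec (M.2 j) - Y j) - (r ^ d / 2) • η) *
      expTwoPiI (∑ j, u j / 2 * (‖intVec (M.1 j) - Y j‖ ^ 2 - ‖intVec (M.2 j) - Y j‖ ^ 2))) := by
  have him : ∀ j, (iwasawaTau (horoPoint r Y u j).lin).im = r ^ 2 := fun j => by
    rw [iwasawaTau_horoPoint hr]; rfl
  have hre : ∀ j, (iwasawaTau (horoPoint r Y u j).lin).re = u j := fun j => by
    rw [iwasawaTau_horoPoint hr]; rfl
  have hv : (r ^ 2) ^ ((d : ℝ) / 2) = r ^ d := by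
    rw [← Real.rpow_natCast r 2, ← Real.rpow_mul hr.le, ← Real.rpow_natCast r d]
    congr 1; push_cast; ring
  have hy : ∀ (m : Fin d → ℤ) (j : Fin k), r • (intVec m - (Y j + (1 / (2 * r)) • r ^ d • η)) =
      r • (intVec m - Y j) - (r ^ d / 2) • η := by
    intro m j
    rw [← sub_sub, smul_sub _ (_ - _), smul_smul, smul_smul]
    congr 2; field_simp
  have hphase : ∀ j, 1 / 2 * u j * (‖intVec (M.1 j) - (Y j + (1 / (2 * r)) • r ^ d • η)‖ ^ 2 -
      ‖intVec (M.2 j) - (Y j + (1 / (2 * r)) • r ^ d • η)‖ ^ 2) +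
      inner ℝ ((u j / (2 * r)) • r ^ d • η) (intVec (M.1 j) - intVec (M.2 j)) =
      u j / 2 * (‖intVec (M.1 j) - Y j‖ ^ 2 - ‖intVec (M.2 j) - Y j‖ ^ 2) := by
    intro j
    have e : intVec (M.1 j) - intVec (M.2 j) =
        (intVec (M.1 j) - Y j) - (intVec (M.2 j) - Y j) := by abel
    rw [e, ← sub_sub, ← sub_sub, norm_sub_sq_real (intVec (M.1 j) - Y j),
      norm_sub_sq_real (intVec (M.2 j) - Y j)]
    simp only [inner_smul_left, inner_smul_right, inner_sub_right,
      real_inner_comm η, RCLike.conj_to_real]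
    field_simp
    ring
  have hexp : ∀ a : Fin k → ℝ, ∏ j, expTwoPiI (a j) = expTwoPiI (∑ j, a j) := by
    intro a
    simp only [expTwoPiI]
    rw [← Complex.exp_sum]; push_cast; rw [Finset.mul_sum]
  unfold thetaTerm
  simp only [horoPoint_mul_lin, horoPoint_mul_x hr, horoPoint_mul_y hr, him, hre,
    iwasawaPhi_horoPoint hr, rotTransform_zero, Real.sqrt_sq hr.le, hv, hy, hphase,
    Finset.prod_mul_distrib, hexp, Finset.prod_const, Finset.card_univ, Fintype.card_fin]
  rw [pow_mul]
  push_cast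
  ring

/-! ### Absolute convergence -/

theorem IsSchwartzTilde.exists_derivDecay {d k : ℕ}
    {f : RMat d k → RMat d k → (Fin k → ℝ) → RVec d → ℝ → ℂ} (hf : IsSchwartzTilde f)
    (T m S : ℕ) : ∃ C : ℝ, 0 ≤ C ∧ ∀ u η ω,
      DerivDecay T m (C * ((1 + ‖η‖) ^ S * (1 + |ω|) ^ S)⁻¹)
        (fun V : RMat d k × RMat d k => f V.1 V.2 u η ω) := by
  choose C hC using fun n => hf.decay n (max T S)
  have hC0 : ∀ n, 0 ≤ C n := fun n => le_trans (by positivity) (hC n 0 0 0 0 0)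
  refine ⟨∑ n ∈ Finset.range (m + 1), C n, Finset.sum_nonneg fun n _ => hC0 n, fun u η ω => ?_⟩
  refine ⟨hf.smooth u η ω, fun l hl V => ?_⟩
  have h1 : C l ≤ ∑ n ∈ Finset.range (m + 1), C n :=
    Finset.single_le_sum (fun n _ => hC0 n) (Finset.mem_range.2 (by omega))
  rw [← div_eq_mul_inv, le_div_iff₀ (by positivity)]
  refine le_trans ?_ ((hC l V.1 V.2 u η ω).trans h1)
  set N := ‖iteratedFDeriv ℝ l (fun V : RMat d k × RMat d k => f V.1 V.2 u η ω) V‖ with hN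
  have h2 : (1 + ‖V‖) ^ T ≤ (1 + ‖V.1‖) ^ (max T S) * (1 + ‖V.2‖) ^ (max T S) := by
    rw [← mul_pow]
    have h3 : 1 + ‖V‖ ≤ (1 + ‖V.1‖) * (1 + ‖V.2‖) := by
      rw [Prod.norm_def]
      rcases max_cases ‖V.1‖ ‖V.2‖ with h | h <;> rw [h.1] <;>
        nlinarith [norm_nonneg V.1, norm_nonneg V.2, mul_nonneg (norm_nonneg V.1) (norm_nonneg V.2)]
    refine (pow_le_pow_right₀ (by linarith [norm_nonneg V]) (le_max_left T S)).trans ?_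
    gcongr
  have h4 : ∀ x : ℝ, 0 ≤ x → (1 + x) ^ S ≤ (1 + x) ^ (max T S) := fun x hx =>
    pow_le_pow_right₀ (by linarith) (le_max_right T S)
  have h5 : (1 : ℝ) ≤ (1 + ‖u‖) ^ (max T S) := one_le_pow₀ (by linarith [norm_nonneg u])
  calc (1 + ‖V‖) ^ T * N * ((1 + ‖η‖) ^ S * (1 + |ω|) ^ S)
      = (1 + ‖V‖) ^ T * 1 * (1 + ‖η‖) ^ S * (1 + |ω|) ^ S * N := by ring
    _ ≤ (1 + ‖V.1‖) ^ (max T S) * (1 + ‖V.2‖) ^ (max T S) * (1 + ‖u‖) ^ (max T S) *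
        (1 + ‖η‖) ^ (max T S) * (1 + |ω|) ^ (max T S) * N := by
        have h6 := h4 ‖η‖ (norm_nonneg _)
        have h7 := h4 |ω| (abs_nonneg _)
        gcongr

theorem IsSchwartzTilde.continuous {d k : ℕ}
    {f : RMat d k → RMat d k → (Fin k → ℝ) → RVec d → ℝ → ℂ} (hf : IsSchwartzTilde f) :
    Continuous (fun p : (RMat d k × RMat d k) × (Fin k → ℝ) × RVec d × ℝ =>
      f p.1.1 p.1.2 p.2.1 p.2.2.1 p.2.2.2) := by
  have h := hf.cont 0
  have h2 := (continuousMultilinearCurryFin0 ℝ (RMat d k × RMat d k) ℂ).continuous.comp h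
  refine h2.congr fun p => ?_
  simp [iteratedFDeriv_zero_eq_comp]

/-- The argument `r (m_j - y_j) - r^d η / 2` of the test function. -/
noncomputable def horoArg {d k : ℕ} (r : ℝ) (Y : RMat d k) (η : RVec d) (m : Fin k → Fin d → ℤ) : RMat d k :=
  fun j => r • (intVec (m j) - Y j) - (r ^ d / 2) • η

theorem horoArg_apply {d k : ℕ} (r : ℝ) (Y : RMat d k) (η : RVec d) (m : Fin k → Fin d → ℤ)
    (j : Fin k) (i : Fin d) :
    horoArg r Y η m j i = r * (m j i - Y j i) - r ^ d / 2 * η i := by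
  simp [horoArg, intVec]

theorem abs_apply_le_norm {d k : ℕ} (X : RMat d k) (j : Fin k) (i : Fin d) : |X j i| ≤ ‖X‖ :=
  (PiLp.norm_apply_le (X j) i).trans (norm_le_pi_norm X j)

/-- The weight `∏ (1 + |m_{ji}|)^{-2}`. -/
noncomputable def intWeight {d k : ℕ} (m : Fin k → Fin d → ℤ) : ℝ :=
  ∏ j, ∏ i, ((1 + |(m j i : ℝ)|) ^ 2)⁻¹

theorem intWeight_nonneg {d k : ℕ} (m : Fin k → Fin d → ℤ) : 0 ≤ intWeight m :=
  Finset.prod_nonneg fun _ _ => Finset.prod_nonneg fun _ _ => by positivity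

theorem summable_and_tsum_le_of_ofReal {α : Type*} {f : α → ℝ} (hf : ∀ a, 0 ≤ f a) {B : ℝ}
    (hB : 0 ≤ B) (h : ∑' a, ENNReal.ofReal (f a) ≤ ENNReal.ofReal B) :
    Summable f ∧ ∑' a, f a ≤ B := by
  have hs : Summable f := by
    have := ENNReal.summable_toReal (ne_top_of_le_ne_top ENNReal.ofReal_ne_top h)
    exact this.congr fun a => ENNReal.toReal_ofReal (hf a)
  refine ⟨hs, ?_⟩
  rw [← ENNReal.ofReal_tsum_of_nonneg hf hs] at h
  exact (ENNReal.ofReal_le_ofReal_iff hB).1 h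

theorem summable_intWeight (d k : ℕ) : Summable (intWeight (d := d) (k := k)) := by
  refine (summable_and_tsum_le_of_ofReal intWeight_nonneg (B := ∏ _j : Fin k, ∏ _i : Fin d, 3)
    (by positivity) ?_).1
  simp only [intWeight]
  have e : ∀ m : Fin k → Fin d → ℤ, ENNReal.ofReal (∏ j, ∏ i, ((1 + |(m j i : ℝ)|) ^ 2)⁻¹) =
      ∏ j, ∏ i, ENNReal.ofReal (((1 + |(m j i : ℝ)|) ^ 2)⁻¹) := fun m => by
    rw [ENNReal.ofReal_prod_of_nonneg fun _ _ => Finset.prod_nonneg fun _ _ => by positivity]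
    refine Finset.prod_congr rfl fun j _ => ?_
    rw [ENNReal.ofReal_prod_of_nonneg fun _ _ => by positivity]
  simp only [e]
  rw [ENNReal.tsum_pi_prod (fun (_ : Fin k) (a : Fin d → ℤ) =>
    ∏ i, ENNReal.ofReal (((1 + |(a i : ℝ)|) ^ 2)⁻¹))]
  rw [ENNReal.ofReal_prod_of_nonneg fun _ _ => by positivity]
  refine Finset.prod_le_prod' fun j _ => ?_
  rw [ENNReal.tsum_pi_prod (fun (_ : Fin d) (a : ℤ) => ENNReal.ofReal (((1 + |(a : ℝ)|) ^ 2)⁻¹)),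
    ENNReal.ofReal_prod_of_nonneg fun _ _ => by positivity]
  refine Finset.prod_le_prod' fun i _ => ?_
  have := tsum_int_abs_mul_le one_pos
  simp only [one_mul] at this
  exact this.trans (ENNReal.ofReal_le_ofReal (by norm_num))

theorem inv_le_intWeight {d k : ℕ} {m : Fin k → Fin d → ℤ} {x : ℝ}
    (h : ∀ j i, 1 + |(m j i : ℝ)| ≤ x) : (x ^ (2 * (d * k)))⁻¹ ≤ intWeight m := by
  have e : (x ^ (2 * (d * k)))⁻¹ = ∏ _j : Fin k, ∏ _i : Fin d, (x ^ 2)⁻¹ := by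
    simp [← pow_mul, mul_assoc]
  rw [e, intWeight]
  have hx : ∀ (j : Fin k) (i : Fin d), 0 < x := fun j i => lt_of_lt_of_le (by positivity) (h j i)
  refine Finset.prod_le_prod (fun j _ => Finset.prod_nonneg fun i _ => by positivity) fun j _ => ?_
  refine Finset.prod_le_prod (fun i _ => by positivity) fun i _ => ?_
  have := hx j i
  have := h j i
  gcongr

/-- A crude bound at fixed r, with K depending on r, which serves only convergence, continuity and
integrability. Each |m_ji| is at most ‖X‖/r + ‖Y‖ + r^(d-1)‖η‖, where X is the argument of f; the
powers of 1 + ‖η‖ lost here are paid for by asking for decay of order S+T. -/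
theorem IsSchwartzTilde.exists_norm_thetaTerm_le {d k : ℕ}
    {f : RMat d k → RMat d k → (Fin k → ℝ) → RVec d → ℝ → ℂ} (hf : IsSchwartzTilde f)
    (Y : RMat d k) {r : ℝ} (hr : 0 < r) (S : ℕ) :
    ∃ K : ℝ, 0 ≤ K ∧ ∀ (u v : Fin k → ℝ) (η : RVec d) (ω : ℝ) M,
      ‖thetaTerm (fun X X' => f X X' v η ω) (horoPoint r Y u * zShift k (r ^ d • η)) M‖ ≤
        K * ((1 + ‖η‖) ^ S * (1 + |ω|) ^ S)⁻¹ * (intWeight M.1 * intWeight M.2) := by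
  set T := 2 * (2 * (d * k)) with hT
  obtain ⟨C, hC, hdec⟩ := hf.exists_derivDecay T 0 (S + T)
  set D : ℝ := 1 + 1 / r + ‖Y‖ + r ^ d / r with hD
  have hD0 : 0 ≤ D := by positivity
  refine ⟨r ^ (d * k) * C * D ^ T, by positivity, fun u v η ω M => ?_⟩
  rw [thetaTerm_horoPoint hr, norm_mul, norm_mul, norm_expTwoPiI, mul_one, Complex.norm_real,
    Real.norm_of_nonneg (by positivity)]
  have h1 := (hdec v η ω).norm_le (horoArg r Y η M.1, horoArg r Y η M.2)
  set x := ‖((horoArg r Y η M.1, horoArg r Y η M.2) : RMat d k × RMat d k)‖ with hx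
  have hx0 : 0 ≤ x := norm_nonneg _
  have hη : 0 ≤ ‖η‖ := norm_nonneg _
  have key : ∀ m : Fin k → Fin d → ℤ, ‖horoArg r Y η m‖ ≤ x → ∀ j i,
      1 + |(m j i : ℝ)| ≤ D * (1 + ‖η‖) * (1 + x) := by
    intro m hm j i
    have h2 := (abs_apply_le_norm (horoArg r Y η m) j i).trans hm
    rw [horoArg_apply] at h2
    have h3 : (m j i : ℝ) = (r * (m j i - Y j i) - r ^ d / 2 * η i) / r + Y j i +
        r ^ d / r / 2 * η i := by field_simp; ring
    have h4 : |(m j i : ℝ)| ≤ x / r + ‖Y‖ + r ^ d / r * ‖η‖ := by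
      rw [h3]
      refine (abs_add_le _ _).trans (add_le_add ((abs_add_le _ _).trans (add_le_add ?_
        (abs_apply_le_norm Y j i))) ?_)
      · rw [abs_div, abs_of_pos hr]; gcongr
      · rw [abs_mul, abs_of_nonneg (by positivity)]
        have : |η i| ≤ ‖η‖ := PiLp.norm_apply_le η i
        have h5 : 0 ≤ r ^ d / r := by positivity
        exact mul_le_mul (by linarith) this (abs_nonneg _) h5
    have e : D * (1 + ‖η‖) * (1 + x) - (1 + (x / r + ‖Y‖ + r ^ d / r * ‖η‖)) =
        1 / r + ‖Y‖ * (‖η‖ + x + ‖η‖ * x) + r ^ d / r * (1 + x + ‖η‖ * x) +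
        ‖η‖ / r * (1 + x) + (‖η‖ + x + ‖η‖ * x) := by
      rw [hD]; ring
    have : 0 ≤ D * (1 + ‖η‖) * (1 + x) - (1 + (x / r + ‖Y‖ + r ^ d / r * ‖η‖)) := by
      rw [e]; positivity
    linarith
  have w1 := inv_le_intWeight (key M.1 (le_max_left _ _))
  have w2 := inv_le_intWeight (key M.2 (le_max_right _ _))
  set P : ℝ := D * (1 + ‖η‖) * (1 + x) with hP
  have hD1 : 0 < D := by positivity
  have hP0 : 0 < P := by positivity
  have w3 : (P ^ T)⁻¹ ≤ intWeight M.1 * intWeight M.2 := by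
    have : (P ^ T)⁻¹ = (P ^ (2 * (d * k)))⁻¹ * (P ^ (2 * (d * k)))⁻¹ := by
      rw [← mul_inv, ← pow_add]; congr 2; omega
    rw [this]
    exact mul_le_mul w1 w2 (by positivity) (intWeight_nonneg _)
  have h6 : (1 + |ω|) ^ S ≤ (1 + |ω|) ^ (S + T) :=
    pow_le_pow_right₀ (by linarith [abs_nonneg ω]) (by omega)
  calc _ ≤ r ^ (d * k) * (C * ((1 + ‖η‖) ^ (S + T) * (1 + |ω|) ^ (S + T))⁻¹ *
        ((1 + x) ^ T)⁻¹) := by gcongr; exact h1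
    _ ≤ r ^ (d * k) * (C * ((1 + ‖η‖) ^ (S + T) * (1 + |ω|) ^ S)⁻¹ * ((1 + x) ^ T)⁻¹) := by
        gcongr
    _ = r ^ (d * k) * C * D ^ T * ((1 + ‖η‖) ^ S * (1 + |ω|) ^ S)⁻¹ * (P ^ T)⁻¹ := by
        rw [hP, mul_pow, mul_pow, pow_add]; field_simp
    _ ≤ _ := by gcongr

theorem summable_intWeight_mul (d k : ℕ) :
    Summable fun M : (Fin k → Fin d → ℤ) × (Fin k → Fin d → ℤ) => intWeight M.1 * intWeight M.2 :=
  (summable_intWeight d k).mul_of_nonneg (summable_intWeight d k) intWeight_nonneg intWeight_nonneg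

theorem IsSchwartzTilde.exists_norm_higherTheta_le {d k : ℕ}
    {f : RMat d k → RMat d k → (Fin k → ℝ) → RVec d → ℝ → ℂ} (hf : IsSchwartzTilde f)
    (Y : RMat d k) {r : ℝ} (hr : 0 < r) (S : ℕ) :
    ∃ K : ℝ, 0 ≤ K ∧ ∀ (u v : Fin k → ℝ) (η : RVec d) (ω : ℝ),
      ‖higherTheta (fun X X' => f X X' v η ω) (horoPoint r Y u * zShift k (r ^ d • η))‖ ≤
        K * ((1 + ‖η‖) ^ S * (1 + |ω|) ^ S)⁻¹ := by
  obtain ⟨K, hK, h⟩ := hf.exists_norm_thetaTerm_le Y hr S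
  refine ⟨K * ∑' M : (Fin k → Fin d → ℤ) × (Fin k → Fin d → ℤ), intWeight M.1 * intWeight M.2,
    mul_nonneg hK (tsum_nonneg fun M => mul_nonneg (intWeight_nonneg _) (intWeight_nonneg _)),
    fun u v η ω => ?_⟩
  rw [mul_right_comm, ← tsum_mul_left]
  exact tsum_of_norm_bounded ((summable_intWeight_mul d k).mul_left _).hasSum (h u v η ω)

theorem IsSchwartzTilde.summable_thetaTerm {d k : ℕ}
    {f : RMat d k → RMat d k → (Fin k → ℝ) → RVec d → ℝ → ℂ} (hf : IsSchwartzTilde f)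
    (Y : RMat d k) {r : ℝ} (hr : 0 < r) (u v : Fin k → ℝ) (η : RVec d) (ω : ℝ) :
    Summable (thetaTerm (fun X X' => f X X' v η ω) (horoPoint r Y u * zShift k (r ^ d • η))) := by
  obtain ⟨K, hK, h⟩ := hf.exists_norm_thetaTerm_le Y hr 0
  exact Summable.of_norm_bounded ((summable_intWeight_mul d k).mul_left _) (h u v η ω)

theorem IsSchwartzTilde.continuous_higherTheta {d k : ℕ}
    {f : RMat d k → RMat d k → (Fin k → ℝ) → RVec d → ℝ → ℂ} (hf : IsSchwartzTilde f)
    (Y : RMat d k) {r : ℝ} (hr : 0 < r) (a : ℝ) :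
    Continuous fun p : (Fin k → ℝ) × ℝ × RVec d =>
      higherTheta (fun X X' => f X X' (a • p.1) p.2.2 p.2.1)
        (horoPoint r Y p.1 * zShift k (r ^ d • p.2.2)) := by
  obtain ⟨K, hK, h⟩ := hf.exists_norm_thetaTerm_le Y hr 0
  simp only [pow_zero, mul_one, inv_one] at h
  refine continuous_tsum (fun M => ?_) ((summable_intWeight_mul d k).mul_left K)
    (fun M p => h p.1 (a • p.1) p.2.2 p.2.1 M)
  simp only [thetaTerm_horoPoint hr]
  have h1 := hf.continuous
  have h2 := continuous_expTwoPiI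
  refine continuous_const.mul (Continuous.mul ?_ (h2.comp (by fun_prop)))
  exact h1.comp (f := fun p : (Fin k → ℝ) × ℝ × RVec d =>
    (((fun j => r • (intVec (M.1 j) - Y j) - (r ^ d / 2) • p.2.2,
      fun j => r • (intVec (M.2 j) - Y j) - (r ^ d / 2) • p.2.2) : RMat d k × RMat d k),
      a • p.1, p.2.2, p.2.1)) (by fun_prop)

/-! ### A pointwise bound for the theta function on a horocycle -/

/-- The direction in which `(r m, r m')` moves if `m_{ji}` increases and `m'_{ji}` decreases by
one. -/
noncomputable def antiStep {d k : ℕ} (r : ℝ) (q : Fin k × Fin d) : RMat d k × RMat d k :=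
  (Pi.single q.1 (EuclideanSpace.single q.2 r), -Pi.single q.1 (EuclideanSpace.single q.2 r))

theorem norm_antiStep_le {d k : ℕ} {r : ℝ} (hr : 0 < r) (q : Fin k × Fin d) :
    ‖(antiStep r q : RMat d k × RMat d k)‖ ≤ r := by
  have h : ‖(Pi.single q.1 (EuclideanSpace.single q.2 r) : RMat d k)‖ = r := by
    rw [Pi.norm_single, PiLp.norm_single, Real.norm_of_nonneg hr.le]
  rw [antiStep, Prod.norm_def, norm_neg, h, max_self]

/-- The index change `(b, c) ↦ (b + c, -c)`. -/
def antiEquiv (d k : ℕ) : ((Fin k × Fin d → ℤ) × (Fin k × Fin d → ℤ)) ≃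
    ((Fin k → Fin d → ℤ) × (Fin k → Fin d → ℤ)) where
  toFun p := (fun j i => p.1 (j, i) + p.2 (j, i), fun j i => -p.2 (j, i))
  invFun M := (fun q => M.1 q.1 q.2 + M.2 q.1 q.2, fun q => -M.2 q.1 q.2)
  left_inv p := by ext <;> simp
  right_inv M := by ext <;> simp

theorem latticePoint_antiStep {d k : ℕ} (r : ℝ) (Y : RMat d k) (η : RVec d)
    (b c : Fin k × Fin d → ℤ) :
    latticePoint (horoArg r Y η (antiEquiv d k (b, 0)).1, horoArg r Y η (antiEquiv d k (b, 0)).2)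
      (antiStep r) c =
    (horoArg r Y η (antiEquiv d k (b, c)).1, horoArg r Y η (antiEquiv d k (b, c)).2) := by
  have h : ∀ (j : Fin k) (i : Fin d), (∑ q : Fin k × Fin d,
      (c q : ℝ) • (Pi.single q.1 (EuclideanSpace.single q.2 r) : RMat d k)) j i = r * c (j, i) := by
    intro j i
    rw [Finset.sum_apply, WithLp.ofLp_sum, Finset.sum_apply, Finset.sum_eq_single (j, i)]
    · simp [mul_comm]
    · rintro ⟨j', i'⟩ - hne
      by_cases hj : j = j'
      · subst hj
        have : i ≠ i' := fun h => hne (by rw [h])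
        simp [this]
      · simp [hj]
    · simp
  refine Prod.ext ?_ ?_
  · funext j; ext i
    have e : (∑ q, (c q : ℝ) • antiStep r q : RMat d k × RMat d k).1 = ∑ q : Fin k × Fin d,
        (c q : ℝ) • (Pi.single q.1 (EuclideanSpace.single q.2 r) : RMat d k) := by
      rw [Prod.fst_sum]; rfl
    rw [latticePoint, Prod.fst_add, e, Pi.add_apply, PiLp.add_apply, h, horoArg_apply,
      horoArg_apply]
    simp [antiEquiv]; ring
  · funext j; ext i
    have e : (∑ q, (c q : ℝ) • antiStep r q : RMat d k × RMat d k).2 = -∑ q : Fin k × Fin d,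
        (c q : ℝ) • (Pi.single q.1 (EuclideanSpace.single q.2 r) : RMat d k) := by
      rw [Prod.snd_sum, ← Finset.sum_neg_distrib]
      exact Finset.sum_congr rfl fun q _ => smul_neg _ _
    rw [latticePoint, Prod.snd_add, e, Pi.add_apply, PiLp.add_apply, Pi.neg_apply, PiLp.neg_apply,
      h, horoArg_apply, horoArg_apply]
    simp [antiEquiv]; ring

/-- In each coordinate (b+c-y)² - (-c-y)² = (b+2c)(b-2y): the squares of c cancel, which is the
purpose of this change of index. -/
theorem phase_antiEquiv {d k : ℕ} (Y : RMat d k) (u : Fin k → ℝ) (b c : Fin k × Fin d → ℤ) :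
    ∑ j, u j / 2 * (‖intVec ((antiEquiv d k (b, c)).1 j) - Y j‖ ^ 2 -
      ‖intVec ((antiEquiv d k (b, c)).2 j) - Y j‖ ^ 2) =
    (∑ q : Fin k × Fin d, u q.1 / 2 * b q * (b q - 2 * Y q.1 q.2)) +
      ∑ q : Fin k × Fin d, u q.1 * (b q - 2 * Y q.1 q.2) * c q := by
  rw [← Finset.sum_add_distrib, Fintype.sum_prod_type]
  refine Finset.sum_congr rfl fun j _ => ?_
  rw [EuclideanSpace.real_norm_sq_eq, EuclideanSpace.real_norm_sq_eq, ← Finset.sum_sub_distrib,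
    Finset.mul_sum]
  refine Finset.sum_congr rfl fun i _ => ?_
  simp [antiEquiv, intVec]
  ring

/-- The two components of the lattice point add up to rb, and the second alone determines rc, in
both cases up to O(‖Y‖ + ‖η‖). The exponent is shared evenly among the coordinates: A powers give
the decay in b_q and two powers sum over c_q, at a cost of 12/r. -/
theorem summable_latticePoint_antiStep {d k : ℕ} {r : ℝ} (hr : 0 < r) (hr1 : r ≤ 1)
    (Y : RMat d k) (η : RVec d) (A : ℕ) (b : Fin k × Fin d → ℤ) :
    let W : (Fin k × Fin d → ℤ) → ℝ := fun c => ((1 + ‖latticePoint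
      (horoArg r Y η (antiEquiv d k (b, 0)).1, horoArg r Y η (antiEquiv d k (b, 0)).2)
      (antiStep r) c‖) ^ ((A + 2) * Fintype.card (Fin k × Fin d)))⁻¹
    Summable W ∧ ∑' c, W c ≤ ∏ q, ((2 * (1 + ‖Y‖) * (1 + ‖η‖)) ^ A *
      ((1 + r * |(b q : ℝ)|) ^ A)⁻¹ * (12 / r)) := by
  intro W
  set D := 2 * (1 + ‖Y‖) * (1 + ‖η‖) with hD
  have hη0 : 0 ≤ ‖η‖ := norm_nonneg η
  have hY0 : 0 ≤ ‖Y‖ := norm_nonneg Y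
  have hterm : ∀ c, W c ≤ ∏ q, (D ^ A * ((1 + r * |(b q : ℝ)|) ^ A)⁻¹ *
      ((1 + |(r * Y q.1 q.2 + r ^ d / 2 * η q.2) + r * (c q : ℝ)|) ^ 2)⁻¹) := by
    intro c
    simp only [W]
    rw [latticePoint_antiStep]
    set V : RMat d k × RMat d k :=
      (horoArg r Y η (antiEquiv d k (b, c)).1, horoArg r Y η (antiEquiv d k (b, c)).2) with hV
    have hV0 : 0 ≤ ‖V‖ := norm_nonneg V
    rw [pow_mul, ← inv_pow, ← Finset.card_univ, ← Finset.prod_const]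
    refine Finset.prod_le_prod (fun q _ => by positivity) fun q _ => ?_
    obtain ⟨j, i⟩ := q
    have h1 : |horoArg r Y η (antiEquiv d k (b, c)).1 j i| ≤ ‖V‖ :=
      (abs_apply_le_norm _ j i).trans (le_max_left _ _)
    have h2 : |horoArg r Y η (antiEquiv d k (b, c)).2 j i| ≤ ‖V‖ :=
      (abs_apply_le_norm _ j i).trans (le_max_right _ _)
    rw [horoArg_apply] at h1 h2
    simp only [antiEquiv, Equiv.coe_fn_mk, Int.cast_add, Int.cast_neg] at h1 h2
    have h3 : |(r * Y j i + r ^ d / 2 * η i) + r * (c (j, i) : ℝ)| ≤ ‖V‖ := by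
      rw [← abs_neg]
      refine le_of_eq_of_le ?_ h2
      congr 1; ring
    have hYi : |Y j i| ≤ ‖Y‖ := abs_apply_le_norm Y j i
    have hηi : |η i| ≤ ‖η‖ := PiLp.norm_apply_le η i
    have h4 : r * |(b (j, i) : ℝ)| ≤ 2 * ‖V‖ + 2 * ‖Y‖ + ‖η‖ := by
      have e : r * (b (j, i) : ℝ) = ((r * (b (j, i) + c (j, i) - Y j i) - r ^ d / 2 * η i) +
          (r * (-c (j, i) - Y j i) - r ^ d / 2 * η i)) + (2 * (r * Y j i) + r ^ d * η i) := by ring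
      have e2 : r * |(b (j, i) : ℝ)| = |r * (b (j, i) : ℝ)| := by rw [abs_mul, abs_of_pos hr]
      have e3 : |2 * (r * Y j i)| ≤ 2 * ‖Y‖ := by
        rw [abs_mul, abs_mul, abs_two, abs_of_pos hr]
        have : r * |Y j i| ≤ 1 * ‖Y‖ := by gcongr
        linarith
      have e4 : |r ^ d * η i| ≤ ‖η‖ := by
        rw [abs_mul, abs_of_pos (by positivity)]
        have : r ^ d * |η i| ≤ 1 * ‖η‖ := by gcongr; exact pow_le_one₀ hr.le hr1
        linarith
      rw [e2, e]
      refine (abs_add_le _ _).trans ?_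
      have e5 := abs_add_le (r * ((b (j, i) : ℝ) + c (j, i) - Y j i) - r ^ d / 2 * η i)
        (r * (-c (j, i) - Y j i) - r ^ d / 2 * η i)
      have e6 := abs_add_le (2 * (r * Y j i)) (r ^ d * η i)
      linarith
    have h5 : 1 + r * |(b (j, i) : ℝ)| ≤ D * (1 + ‖V‖) := by
      have : D * (1 + ‖V‖) - (1 + (2 * ‖V‖ + 2 * ‖Y‖ + ‖η‖)) =
          1 + ‖η‖ + 2 * ‖Y‖ * ‖η‖ + 2 * ‖V‖ * (‖Y‖ + ‖η‖ + ‖Y‖ * ‖η‖) := by rw [hD]; ring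
      have h6 : 0 ≤ D * (1 + ‖V‖) - (1 + (2 * ‖V‖ + 2 * ‖Y‖ + ‖η‖)) := by rw [this]; positivity
      linarith
    rw [pow_add, mul_inv]
    have h7 : ((1 + ‖V‖) ^ A)⁻¹ ≤ D ^ A * ((1 + r * |(b (j, i) : ℝ)|) ^ A)⁻¹ := by
      rw [← div_eq_mul_inv, inv_eq_one_div, div_le_div_iff₀ (by positivity) (by positivity),
        one_mul, ← mul_pow]
      gcongr
    dsimp only
    gcongr
  refine summable_and_tsum_le_of_ofReal (fun c => by positivity)
    (Finset.prod_nonneg fun q _ => by positivity) ?_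
  calc ∑' c, ENNReal.ofReal (W c)
      ≤ ∑' c : Fin k × Fin d → ℤ, ∏ q, ENNReal.ofReal (D ^ A * ((1 + r * |(b q : ℝ)|) ^ A)⁻¹ *
        ((1 + |(r * Y q.1 q.2 + r ^ d / 2 * η q.2) + r * (c q : ℝ)|) ^ 2)⁻¹) := by
        refine ENNReal.tsum_le_tsum fun c => ?_
        rw [← ENNReal.ofReal_prod_of_nonneg fun q _ => by positivity]
        exact ENNReal.ofReal_le_ofReal (hterm c)
    _ = ∏ q : Fin k × Fin d, ∑' n : ℤ, ENNReal.ofReal (D ^ A * ((1 + r * |(b q : ℝ)|) ^ A)⁻¹ *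
        ((1 + |(r * Y q.1 q.2 + r ^ d / 2 * η q.2) + r * (n : ℝ)|) ^ 2)⁻¹) :=
        ENNReal.tsum_pi_prod (fun (q : Fin k × Fin d) (n : ℤ) => ENNReal.ofReal
          (D ^ A * ((1 + r * |(b q : ℝ)|) ^ A)⁻¹ *
          ((1 + |(r * Y q.1 q.2 + r ^ d / 2 * η q.2) + r * (n : ℝ)|) ^ 2)⁻¹))
    _ ≤ ∏ q : Fin k × Fin d, ENNReal.ofReal (D ^ A * ((1 + r * |(b q : ℝ)|) ^ A)⁻¹ * (12 / r)) := by
        refine Finset.prod_le_prod' fun q _ => ?_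
        have e : ∀ n : ℤ, ENNReal.ofReal (D ^ A * ((1 + r * |(b q : ℝ)|) ^ A)⁻¹ *
          ((1 + |(r * Y q.1 q.2 + r ^ d / 2 * η q.2) + r * (n : ℝ)|) ^ 2)⁻¹) =
          ENNReal.ofReal (D ^ A * ((1 + r * |(b q : ℝ)|) ^ A)⁻¹) * ENNReal.ofReal
          (((1 + |(r * Y q.1 q.2 + r ^ d / 2 * η q.2) + r * (n : ℝ)|) ^ 2)⁻¹) := fun n =>
            ENNReal.ofReal_mul (by positivity)
        simp only [e]
        rw [ENNReal.tsum_mul_left, ENNReal.ofReal_mul (q := 12 / r) (by positivity)]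
        gcongr
        refine (tsum_int_shift_le hr _).trans (ENNReal.ofReal_le_ofReal ?_)
        rw [le_div_iff₀ hr]
        have : (1 + r) ^ 2 * (1 + 2 / r) * r = (1 + r) ^ 2 * (r + 2) := by field_simp
        rw [this]; nlinarith [mul_pos hr hr]
    _ = _ := (ENNReal.ofReal_prod_of_nonneg fun q _ => by positivity).symm

-- Unlike the crude bound, this one is uniform in r ≤ 1: the factor r^(dk) cancels the product of
-- the 12/r from the sums over c. The oscillation in c and the decay in b are together the weight in
-- `shearSum`. The decay S + A·n in η absorbs the power A·n produced by the translation of the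
-- lattice.
set_option maxHeartbeats 1000000 in
theorem IsSchwartzTilde.exists_enorm_higherTheta_le {d k : ℕ}
    {f : RMat d k → RMat d k → (Fin k → ℝ) → RVec d → ℝ → ℂ} (hf : IsSchwartzTilde f)
    (Y : RMat d k) (A S : ℕ) :
    ∃ K : ℝ, 0 ≤ K ∧ ∀ (r : ℝ), 0 < r → r ≤ 1 → ∀ (u v : Fin k → ℝ) (η : RVec d) (ω : ℝ),
      ‖higherTheta (fun X X' => f X X' v η ω) (horoPoint r Y u * zShift k (r ^ d • η))‖ₑ ≤
        ENNReal.ofReal (K * ((1 + ‖η‖) ^ S * (1 + |ω|) ^ S)⁻¹) *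
          ∏ j, ∏ i, shearSum A r (Y j i) (u j) := by
  set n := Fintype.card (Fin k × Fin d) with hn
  have hn' : n = d * k := by simp [hn, mul_comm]
  set T := (A + 2) * n with hT
  obtain ⟨C, hC, hdec⟩ := hf.exists_derivDecay T (A * n) (S + A * n)
  refine ⟨C * (2 ^ (T + 1)) ^ (A * n) * ((2 * (1 + ‖Y‖)) ^ A * 12) ^ n, by positivity,
    fun r hr hr1 u v η ω => ?_⟩
  set g : RMat d k × RMat d k → ℂ := fun V => f V.1 V.2 v η ω with hg
  set x₀ : (Fin k × Fin d → ℤ) → RMat d k × RMat d k := fun b =>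
    (horoArg r Y η (antiEquiv d k (b, 0)).1, horoArg r Y η (antiEquiv d k (b, 0)).2) with hx₀
  set s : (Fin k × Fin d → ℤ) → Fin k × Fin d → ℝ := fun b q =>
    u q.1 * (b q - 2 * Y q.1 q.2) with hs
  set B : ℝ := C * ((1 + ‖η‖) ^ (S + A * n) * (1 + |ω|) ^ (S + A * n))⁻¹ with hB
  have hB0 : 0 ≤ B := by positivity
  have hc0 : ∀ t : ℝ, 0 ≤ circleNorm t := fun t => norm_nonneg _
  have hterm : ∀ b c, thetaTerm (fun X X' => f X X' v η ω)
      (horoPoint r Y u * zShift k (r ^ d • η)) (antiEquiv d k (b, c)) =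
      (r ^ (d * k) : ℝ) * expTwoPiI (∑ q, u q.1 / 2 * b q * (b q - 2 * Y q.1 q.2)) *
        (g (latticePoint (x₀ b) (antiStep r) c) * expTwoPiI (∑ q, s b q * c q)) := by
    intro b c
    rw [thetaTerm_horoPoint hr, phase_antiEquiv, expTwoPiI_add, latticePoint_antiStep]
    change _ * (g (horoArg r Y η (antiEquiv d k (b, c)).1, horoArg r Y η (antiEquiv d k (b, c)).2) *
      (_ * expTwoPiI (∑ q, s b q * c q))) = _
    ring
  have hsum : Summable fun p : (Fin k × Fin d → ℤ) × (Fin k × Fin d → ℤ) =>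
      thetaTerm (fun X X' => f X X' v η ω) (horoPoint r Y u * zShift k (r ^ d • η))
        (antiEquiv d k p) :=
    ((antiEquiv d k).summable_iff).2 (hf.summable_thetaTerm Y hr u v η ω)
  have hinner : ∀ b, ‖∑' c, thetaTerm (fun X X' => f X X' v η ω)
      (horoPoint r Y u * zShift k (r ^ d • η)) (antiEquiv d k (b, c))‖ₑ ≤
      ENNReal.ofReal (C * (2 ^ (T + 1)) ^ (A * n) * ((2 * (1 + ‖Y‖)) ^ A * 12) ^ n *
        ((1 + ‖η‖) ^ S * (1 + |ω|) ^ S)⁻¹) * ∏ q : Fin k × Fin d, ENNReal.ofReal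
        (((1 + r * |(b q : ℝ)|) ^ A * (1 + circleNorm (s b q) / r) ^ A)⁻¹) := by
    intro b
    obtain ⟨hW, hWle⟩ := summable_latticePoint_antiStep hr hr1 Y η A b
    simp only [hterm b]
    rw [tsum_mul_left, ← ENNReal.ofReal_prod_of_nonneg fun q _ => by
        have := hc0 (s b q); positivity,
      ← ENNReal.ofReal_mul (by positivity), ← ofReal_norm, norm_mul, norm_mul,
      norm_expTwoPiI, mul_one, Complex.norm_real, Real.norm_of_nonneg (by positivity)]
    refine ENNReal.ofReal_le_ofReal ?_
    have h1 := (hdec v η ω).norm_oscSum_le hr hr1 (norm_antiStep_le hr) hW (s b)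
    have hp0 : 0 ≤ ∏ q, ((1 + circleNorm (s b q) / r) ^ A)⁻¹ :=
      Finset.prod_nonneg fun q _ => by have := hc0 (s b q); positivity
    have h2 : ‖oscSum g (x₀ b) (antiStep r) (s b)‖ ≤ B * (2 ^ (T + 1)) ^ (A * n) *
        (∏ q, ((2 * (1 + ‖Y‖) * (1 + ‖η‖)) ^ A * ((1 + r * |(b q : ℝ)|) ^ A)⁻¹ * (12 / r))) *
        ∏ q, ((1 + circleNorm (s b q) / r) ^ A)⁻¹ := h1.trans (by gcongr)
    have e1 : ∏ q, ((2 * (1 + ‖Y‖) * (1 + ‖η‖)) ^ A * ((1 + r * |(b q : ℝ)|) ^ A)⁻¹ * (12 / r)) =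
        ((2 * (1 + ‖Y‖)) ^ A * 12) ^ n * ((1 + ‖η‖) ^ (A * n) / r ^ n) *
        ∏ q, ((1 + r * |(b q : ℝ)|) ^ A)⁻¹ := by
      rw [Finset.prod_mul_distrib, Finset.prod_mul_distrib, Finset.prod_const, Finset.prod_const,
        Finset.card_univ, ← hn, mul_pow _ (1 + ‖η‖), mul_pow _ ((1 + ‖η‖) ^ A), ← pow_mul (1 + ‖η‖),
        div_pow, mul_pow _ (12 : ℝ)]
      ring
    have e2 : ∏ q, ((1 + r * |(b q : ℝ)|) ^ A * (1 + circleNorm (s b q) / r) ^ A)⁻¹ =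
        (∏ q, ((1 + r * |(b q : ℝ)|) ^ A)⁻¹) * ∏ q, ((1 + circleNorm (s b q) / r) ^ A)⁻¹ := by
      rw [← Finset.prod_mul_distrib]; simp only [mul_inv]
    have hp1 : 0 ≤ ∏ q, ((1 + r * |(b q : ℝ)|) ^ A)⁻¹ :=
      Finset.prod_nonneg fun q _ => by positivity
    have h3 : (1 + |ω|) ^ S ≤ (1 + |ω|) ^ (S + A * n) :=
      pow_le_pow_right₀ (by linarith [abs_nonneg ω]) (by omega)
    have h4 : B * (1 + ‖η‖) ^ (A * n) ≤ C * ((1 + ‖η‖) ^ S * (1 + |ω|) ^ S)⁻¹ := by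
      calc B * (1 + ‖η‖) ^ (A * n)
          ≤ C * ((1 + ‖η‖) ^ (S + A * n) * (1 + |ω|) ^ S)⁻¹ * (1 + ‖η‖) ^ (A * n) := by
            rw [hB]; gcongr
        _ = _ := by rw [pow_add]; field_simp
    rw [e2, ← hn']
    calc _ ≤ r ^ n * (B * (2 ^ (T + 1)) ^ (A * n) * (((2 * (1 + ‖Y‖)) ^ A * 12) ^ n *
          ((1 + ‖η‖) ^ (A * n) / r ^ n) * ∏ q, ((1 + r * |(b q : ℝ)|) ^ A)⁻¹) *
          ∏ q, ((1 + circleNorm (s b q) / r) ^ A)⁻¹) := by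
          rw [← e1]; gcongr
          exact h2
      _ = (2 ^ (T + 1)) ^ (A * n) * ((2 * (1 + ‖Y‖)) ^ A * 12) ^ n *
          (B * (1 + ‖η‖) ^ (A * n)) * ((∏ q, ((1 + r * |(b q : ℝ)|) ^ A)⁻¹) *
          ∏ q, ((1 + circleNorm (s b q) / r) ^ A)⁻¹) := by
          field_simp
      _ ≤ (2 ^ (T + 1)) ^ (A * n) * ((2 * (1 + ‖Y‖)) ^ A * 12) ^ n *
          (C * ((1 + ‖η‖) ^ S * (1 + |ω|) ^ S)⁻¹) * ((∏ q, ((1 + r * |(b q : ℝ)|) ^ A)⁻¹) *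
          ∏ q, ((1 + circleNorm (s b q) / r) ^ A)⁻¹) := by gcongr
      _ = _ := by ring
  rw [higherTheta, ← (antiEquiv d k).tsum_eq, hsum.tsum_prod]
  refine (enorm_tsum_le_tsum_enorm).trans ?_
  refine (ENNReal.tsum_le_tsum hinner).trans_eq ?_
  rw [ENNReal.tsum_mul_left]
  congr 1
  rw [ENNReal.tsum_pi_prod (fun (q : Fin k × Fin d) (b : ℤ) => ENNReal.ofReal
    (((1 + r * |(b : ℝ)|) ^ A * (1 + circleNorm (u q.1 * (b - 2 * Y q.1 q.2)) / r) ^ A)⁻¹)),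
    Fintype.prod_prod_type]
  rfl

/-! ### The mean of the theta function -/

theorem integrable_inv_one_add_norm_pow {E : Type*} [NormedAddCommGroup E] [NormedSpace ℝ E]
    [FiniteDimensional ℝ E] [MeasurableSpace E] [BorelSpace E] {μ : Measure E}
    [μ.IsAddHaarMeasure] {n : ℕ} (hn : Module.finrank ℝ E < n) :
    Integrable (fun x : E => ((1 + ‖x‖) ^ n)⁻¹) μ := by
  have h : Integrable (fun x : E => (1 + ‖x‖) ^ (-(n : ℝ))) μ :=
    integrable_one_add_norm (by exact_mod_cast hn)
  refine h.congr (ae_of_all _ fun x => ?_)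
  simp only
  rw [Real.rpow_neg (by positivity), Real.rpow_natCast]

theorem lintegral_pi_prod {n : ℕ} {X : Type*} [MeasurableSpace X] (μ : Measure X) [SigmaFinite μ]
    {f : Fin n → X → ℝ≥0∞} (hf : ∀ i, Measurable (f i)) :
    ∫⁻ x, ∏ i, f i (x i) ∂(Measure.pi fun _ => μ) = ∏ i, ∫⁻ x, f i x ∂μ := by
  induction n with
  | zero => simp
  | succ n ih =>
    rw [((measurePreserving_piFinSuccAbove (fun _ => μ) 0).symm).lintegral_map_equiv]
    simp_rw [MeasurableEquiv.piFinSuccAbove_symm_apply, Fin.insertNthEquiv,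
      Fin.prod_univ_succ, Fin.insertNth_zero, Equiv.coe_fn_mk, Fin.cons_succ, Fin.cons_zero]
    rw [← ih (fun i => hf i.succ)]
    refine lintegral_prod_mul (μ := μ) (ν := Measure.pi fun _ : Fin n => μ) (f := f 0)
      (g := fun x => ∏ i : Fin n, f i.succ (x i)) (hf 0).aemeasurable (Measurable.aemeasurable ?_)
    refine Finset.measurable_fun_prod _ fun i _ => (hf i.succ).comp (measurable_pi_apply i)

/-- The integral of `(1 + ‖η‖)^{-(d+1)}` over `ℝ^d`. -/
noncomputable def decayMass (d : ℕ) : ℝ := ∫ η : RVec d, ((1 + ‖η‖) ^ (d + 1))⁻¹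

theorem decayMass_nonneg (d : ℕ) : 0 ≤ decayMass d := integral_nonneg fun η => by positivity

theorem integrable_decay (d : ℕ) : Integrable fun η : RVec d => ((1 + ‖η‖) ^ (d + 1))⁻¹ :=
  integrable_inv_one_add_norm_pow (by simp)

theorem integrable_decay_line : Integrable fun ω : ℝ => ((1 + |ω|) ^ 2)⁻¹ := by
  simpa only [Real.norm_eq_abs] using
    integrable_inv_one_add_norm_pow (E := ℝ) (μ := volume) (n := 2) (by simp)

/-- For 0 < β < 1 one has x^β ≤ 1 + x, so the bound is linear in K and a first moment of theta
suffices later. The condition Sβ ≥ 2 keeps the β-th power integrable in ω. -/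
theorem norm_integral_rpow_le {d S : ℕ} {β : ℝ} (hβ0 : 0 < β) (hβ1 : β < 1) (hS1 : d + 1 ≤ S)
    (hS2 : 2 ≤ S * β) {K ω : ℝ} (hK : 0 ≤ K) {F : RVec d → ℂ}
    (h : ∀ η, ‖F η‖ ≤ K * ((1 + ‖η‖) ^ S * (1 + |ω|) ^ S)⁻¹) :
    ‖∫ η, F η‖ ^ β ≤ (1 + K * decayMass d) * ((1 + |ω|) ^ 2)⁻¹ := by
  have hJ := decayMass_nonneg d
  have hω : 0 ≤ |ω| := abs_nonneg ω
  have h1 : ‖∫ η, F η‖ ≤ K * decayMass d * ((1 + |ω|) ^ S)⁻¹ := by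
    have e : K * decayMass d * ((1 + |ω|) ^ S)⁻¹ =
        ∫ η : RVec d, K * ((1 + |ω|) ^ S)⁻¹ * ((1 + ‖η‖) ^ (d + 1))⁻¹ := by
      rw [integral_const_mul, decayMass]; ring
    rw [e]
    refine norm_integral_le_of_norm_le ((integrable_decay d).const_mul _)
      (ae_of_all _ fun η => (h η).trans ?_)
    rw [mul_inv, mul_assoc, mul_comm (((1 + |ω|) ^ S)⁻¹)]
    have : (1 + ‖η‖) ^ (d + 1) ≤ (1 + ‖η‖) ^ S :=
      pow_le_pow_right₀ (by linarith [norm_nonneg η]) hS1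
    gcongr
  calc ‖∫ η, F η‖ ^ β ≤ (K * decayMass d * ((1 + |ω|) ^ S)⁻¹) ^ β := by gcongr
    _ = (K * decayMass d) ^ β * ((1 + |ω|) ^ (S * β))⁻¹ := by
        rw [Real.mul_rpow (by positivity) (by positivity), Real.inv_rpow (by positivity),
          ← Real.rpow_natCast, ← Real.rpow_mul (by positivity)]
    _ ≤ (1 + K * decayMass d) * ((1 + |ω|) ^ 2)⁻¹ := by
        have h2 : (K * decayMass d) ^ β ≤ 1 + K * decayMass d := by
          have h3 : 0 ≤ K * decayMass d := by positivity
          rcases le_total (K * decayMass d) 1 with h4 | h4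
          · linarith [Real.rpow_le_one h3 h4 hβ0.le]
          · have := Real.rpow_le_rpow_of_exponent_le h4 hβ1.le
            rw [Real.rpow_one] at this; linarith
        have h5 : (1 + |ω|) ^ 2 ≤ (1 + |ω|) ^ (S * β) := by
          rw [← Real.rpow_natCast]
          exact Real.rpow_le_rpow_of_exponent_le (by linarith) (by exact_mod_cast hS2)
        gcongr

section

variable {d k : ℕ} {f : RMat d k → RMat d k → (Fin k → ℝ) → RVec d → ℝ → ℂ}

theorem IsSchwartzTilde.stronglyMeasurable_integral_rpow (hf : IsSchwartzTilde f) {β : ℝ}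
    (hβ0 : 0 < β) (Y : RMat d k) {r : ℝ} (hr : 0 < r) (a : ℝ) :
    StronglyMeasurable fun p : (Fin k → ℝ) × ℝ => ‖∫ η : RVec d,
      higherTheta (fun X X' => f X X' (a • p.1) η p.2)
        (horoPoint r Y p.1 * zShift k (r ^ d • η))‖ ^ β := by
  have h := hf.continuous_higherTheta Y hr a
  have h1 : StronglyMeasurable fun q : ((Fin k → ℝ) × ℝ) × RVec d =>
      higherTheta (fun X X' => f X X' (a • q.1.1) q.2 q.1.2)
        (horoPoint r Y q.1.1 * zShift k (r ^ d • q.2)) :=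
    (h.comp (f := fun q : ((Fin k → ℝ) × ℝ) × RVec d => (q.1.1, q.1.2, q.2))
      (by fun_prop)).stronglyMeasurable
  have h2 := h1.integral_prod_right' (ν := volume)
  exact (Real.continuous_rpow_const hβ0.le).comp_stronglyMeasurable h2.norm

theorem IsSchwartzTilde.higherFConverges (hf : IsSchwartzTilde f) {β : ℝ} (hβ0 : 0 < β)
    (hβ1 : β < 1) {S : ℕ} (hS1 : d + 1 ≤ S) (hS2 : 2 ≤ S * β) (Y : RMat d k) {r : ℝ} (hr : 0 < r)
    (a : ℝ) (u : Fin k → ℝ) : HigherFConverges f β r (horoPoint r Y u) (a • u) := by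
  obtain ⟨K, hK, hbound⟩ := hf.exists_norm_higherTheta_le Y hr S
  refine ⟨fun η ω => hf.summable_thetaTerm Y hr u _ η ω, fun ω => ?_, ?_⟩
  · have hc := (hf.continuous_higherTheta Y hr a).comp (f := fun η : RVec d => (u, ω, η))
      (by fun_prop)
    refine ((integrable_decay d).const_mul K).mono' hc.aestronglyMeasurable
      (ae_of_all _ fun η => (hbound u (a • u) η ω).trans ?_)
    gcongr
    have h1 : (1 + ‖η‖) ^ (d + 1) ≤ (1 + ‖η‖) ^ S :=
      pow_le_pow_right₀ (by linarith [norm_nonneg η]) hS1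
    refine h1.trans (le_mul_of_one_le_right (by positivity) (one_le_pow₀ ?_))
    linarith [abs_nonneg ω]
  · have hm := (hf.stronglyMeasurable_integral_rpow hβ0 Y hr a).comp_measurable
      (measurable_prodMk_left (x := u))
    refine (integrable_decay_line.const_mul (1 + K * decayMass d)).mono' hm.aestronglyMeasurable
      (ae_of_all _ fun ω => ?_)
    rw [Real.norm_of_nonneg (by positivity)]
    exact norm_integral_rpow_le hβ0 hβ1 hS1 hS2 hK fun η => hbound u (a • u) η ω

theorem higherF_nonneg (β r : ℝ) (g : Fin k → ThetaGroup d) (u : Fin k → ℝ) :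
    0 ≤ higherF f β r g u := integral_nonneg fun ω => by positivity

theorem higherF_le {β : ℝ} (hβ0 : 0 < β) (hβ1 : β < 1) {S : ℕ} (hS1 : d + 1 ≤ S)
    (hS2 : 2 ≤ S * β) {r : ℝ} {g : Fin k → ThetaGroup d} {v : Fin k → ℝ} {K : ℝ} (hK : 0 ≤ K)
    (h : ∀ η ω, ‖higherTheta (fun X X' => f X X' v η ω) (g * zShift k (r ^ d • η))‖ ≤
      K * ((1 + ‖η‖) ^ S * (1 + |ω|) ^ S)⁻¹) :
    higherF f β r g v ≤ (1 + K * decayMass d) * ∫ ω : ℝ, ((1 + |ω|) ^ 2)⁻¹ := by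
  rw [← integral_const_mul]
  exact integral_mono_of_nonneg (ae_of_all _ fun ω => by positivity)
    (integrable_decay_line.const_mul _)
    (ae_of_all _ fun ω => norm_integral_rpow_le hβ0 hβ1 hS1 hS2 hK fun η => h η ω)

theorem integrable_of_bounded_hasCompactSupport {w : (Fin k → ℝ) → ℝ} (hwm : AEMeasurable w)
    {B : ℝ} (hwb : ∀ u, |w u| ≤ B) (hwc : HasCompactSupport w) : Integrable w := by
  have h : IntegrableOn w (tsupport w) :=
    Measure.integrableOn_of_bounded hwc.isCompact.measure_lt_top.ne hwm.aestronglyMeasurable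
      (ae_of_all _ hwb)
  rwa [integrableOn_iff_integrable_of_support_subset (subset_tsupport w)] at h

theorem IsSchwartzTilde.integrable_higherF_mul (hf : IsSchwartzTilde f) {β : ℝ} (hβ0 : 0 < β)
    (hβ1 : β < 1) {S : ℕ} (hS1 : d + 1 ≤ S) (hS2 : 2 ≤ S * β) (Y : RMat d k) {r : ℝ} (hr : 0 < r)
    {a : ℝ} (ha : a ≠ 0) {w : (Fin k → ℝ) → ℝ} (hw : Integrable w) :
    Integrable fun u : Fin k → ℝ => higherF f β r (horoPoint r Y u) (a • u) * w (a • u) := by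
  obtain ⟨K, hK, hbound⟩ := hf.exists_norm_higherTheta_le Y hr S
  have hm : StronglyMeasurable fun u : Fin k → ℝ => higherF f β r (horoPoint r Y u) (a • u) :=
    (hf.stronglyMeasurable_integral_rpow hβ0 Y hr a).integral_prod_right'
  refine (hw.comp_smul ha).bdd_mul
    (c := (1 + K * decayMass d) * ∫ ω : ℝ, ((1 + |ω|) ^ 2)⁻¹) hm.aestronglyMeasurable
    (ae_of_all _ fun u => ?_)
  rw [Real.norm_of_nonneg (higherF_nonneg _ _ _ _)]
  exact higherF_le hβ0 hβ1 hS1 hS2 hK fun η ω => hbound u (a • u) η ω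

theorem IsSchwartzTilde.exists_enorm_higherF_le (hf : IsSchwartzTilde f) {β : ℝ} (hβ0 : 0 < β)
    (hβ1 : β < 1) {S : ℕ} (hS1 : d + 1 ≤ S) (hS2 : 2 ≤ S * β) (Y : RMat d k) (A : ℕ) :
    ∃ C : ℝ, 0 < C ∧ ∀ r : ℝ, 0 < r → r ≤ 1 → ∀ u v : Fin k → ℝ,
      ‖higherF f β r (horoPoint r Y u) v‖ₑ ≤ ENNReal.ofReal C *
        (1 + ∏ j, ∏ i, shearSum A r (Y j i) (u j)) := by
  obtain ⟨K, hK, hbound⟩ := hf.exists_enorm_higherTheta_le Y A S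
  have hJ := decayMass_nonneg d
  set I : ℝ := ∫ ω : ℝ, ((1 + |ω|) ^ 2)⁻¹ with hI
  have hI0 : 0 ≤ I := integral_nonneg fun ω => by positivity
  refine ⟨(1 + K * decayMass d) * (I + 1), by positivity, fun r hr hr1 u v => ?_⟩
  set P := ∏ j, ∏ i, shearSum A r (Y j i) (u j) with hP
  -- The exponent A is arbitrary here, so the product may be infinite; then the bound is void.
  rcases eq_or_ne P ⊤ with htop | htop
  · rw [htop, add_top, ENNReal.mul_top]
    · exact le_top
    · rw [Ne, ENNReal.ofReal_eq_zero, not_le]; positivity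
  · have hPr : P = ENNReal.ofReal P.toReal := (ENNReal.ofReal_toReal htop).symm
    have hP0 : 0 ≤ P.toReal := ENNReal.toReal_nonneg
    have h1 : higherF f β r (horoPoint r Y u) v ≤ (1 + (K * P.toReal) * decayMass d) * I := by
      refine higherF_le hβ0 hβ1 hS1 hS2 (by positivity) fun η ω => ?_
      have h2 := hbound r hr hr1 u v η ω
      rw [← hP, hPr, ← ENNReal.ofReal_mul (by positivity), ← ofReal_norm,
        ENNReal.ofReal_le_ofReal_iff (by positivity)] at h2
      refine h2.trans_eq ?_
      ring
    rw [hPr, ← ENNReal.ofReal_one, ← ENNReal.ofReal_add zero_le_one hP0,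
      ← ENNReal.ofReal_mul (by positivity), ← ofReal_norm,
      Real.norm_of_nonneg (higherF_nonneg _ _ _ _)]
    refine ENNReal.ofReal_le_ofReal (h1.trans ?_)
    have h3 : 0 ≤ K * decayMass d := by positivity
    have e : (1 + K * decayMass d) * (I + 1) * (1 + P.toReal) -
        (1 + K * P.toReal * decayMass d) * I = (1 + P.toReal) * (1 + K * decayMass d) +
        I * (P.toReal + K * decayMass d) := by ring
    have : 0 ≤ (1 + K * decayMass d) * (I + 1) * (1 + P.toReal) -
        (1 + K * P.toReal * decayMass d) * I := by rw [e]; positivity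
    linarith

end

/-! ### Integration over the box and the final bound -/

theorem exists_lintegral_box_le {d k : ℕ} (hd : 2 ≤ d) {κ : ℝ}
    (hκ : κ * ((d : ℝ) - 2) < (d : ℝ) - 1) (Y : RMat d k) (hY : ∀ j, IsDiophantineVec κ (Y j))
    {R : ℝ} (hR : 1 ≤ R) : ∃ C : ℝ, 0 ≤ C ∧ ∀ r : ℝ, 0 < r → r ≤ 1 →
      ∫⁻ u in Set.univ.pi fun _ : Fin k => Set.Icc (-(R / r ^ (d - 2))) (R / r ^ (d - 2)),
        (1 + ∏ j, ∏ i, shearSum (d + 4) r (Y j i) (u j)) ≤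
      ENNReal.ofReal (C / r ^ (k * (d - 2))) := by
  choose C hC0 hC using fun j => lintegral_prod_shearSum_le hd (Y j) hκ (hY j) hR
  refine ⟨(2 * R) ^ k + ∏ j, C j, add_nonneg (by positivity) (Finset.prod_nonneg fun j _ => hC0 j),
    fun r hr hr1 => ?_⟩
  have hm : ∀ j, Measurable fun x : ℝ => ∏ i, shearSum (d + 4) r (Y j i) x := fun j =>
    Finset.measurable_fun_prod _ fun i _ => measurable_shearSum _ _ _
  -- The constant 1 contributes the volume of the box, which is of order r^(-k(d-2)) like the
  -- product term; the latter factorizes by Tonelli.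
  rw [lintegral_add_left measurable_const, volume_pi, Measure.restrict_pi_pi,
    lintegral_pi_prod _ hm, lintegral_one, Measure.pi_univ]
  have e1 : ∏ _j : Fin k, (volume.restrict (Set.Icc (-(R / r ^ (d - 2))) (R / r ^ (d - 2)))) Set.univ
      = ENNReal.ofReal ((2 * R) ^ k / r ^ (k * (d - 2))) := by
    rw [Measure.restrict_apply_univ, Real.volume_Icc, Finset.prod_const, Finset.card_univ,
      Fintype.card_fin, ← ENNReal.ofReal_pow (by rw [sub_neg_eq_add]; positivity)]
    congr 1
    rw [mul_comm k, pow_mul, ← div_pow]; congr 1; ring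
  have e2 : ∏ j, ∫⁻ x in Set.Icc (-(R / r ^ (d - 2))) (R / r ^ (d - 2)),
      ∏ i, shearSum (d + 4) r (Y j i) x ≤
      ENNReal.ofReal ((∏ j, C j) / r ^ (k * (d - 2))) := by
    refine (Finset.prod_le_prod' fun j _ => hC j r hr hr1).trans_eq ?_
    rw [← ENNReal.ofReal_prod_of_nonneg fun j _ => div_nonneg (hC0 j) (by positivity),
      Finset.prod_div_distrib, Finset.prod_const, Finset.card_univ, Fintype.card_fin,
      ← pow_mul, mul_comm k]
  rw [e1, add_div, ENNReal.ofReal_add (by positivity)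
    (div_nonneg (Finset.prod_nonneg fun j _ => hC0 j) (by positivity))]
  gcongr

theorem IsSchwartzTilde.exists_abs_mean_le {d k : ℕ} (hd : 2 ≤ d)
    {f : RMat d k → RMat d k → (Fin k → ℝ) → RVec d → ℝ → ℂ} (hf : IsSchwartzTilde f)
    {β : ℝ} (hβ0 : 0 < β) (hβ1 : β < 1) {S : ℕ} (hS1 : d + 1 ≤ S) (hS2 : 2 ≤ S * β) {κ : ℝ}
    (hκ : κ * ((d : ℝ) - 2) < (d : ℝ) - 1) (Y : RMat d k) (hY : ∀ j, IsDiophantineVec κ (Y j))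
    {w : (Fin k → ℝ) → ℝ} {B : ℝ} (hwb : ∀ u, |w u| ≤ B) (hwc : HasCompactSupport w) :
    ∃ C : ℝ, ∀ r : ℝ, 0 < r → r ≤ 1 → |r ^ (k * (d - 2)) * ∫ u : Fin k → ℝ,
      higherF f β r (horoPoint r Y u) (r ^ (d - 2) • u) * w (r ^ (d - 2) • u)| ≤ C := by
  have hB0 : 0 ≤ B := (abs_nonneg _).trans (hwb 0)
  obtain ⟨R₀, hR₀⟩ := hwc.isCompact.isBounded.subset_closedBall 0
  -- R ≥ 1 makes the half side R/r^(d-2) of the box at least 1, as the one-variable estimate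
  -- requires.
  set R := max R₀ 1 with hR
  have hR1 : 1 ≤ R := le_max_right _ _
  obtain ⟨C, hC, hF⟩ := hf.exists_enorm_higherF_le hβ0 hβ1 hS1 hS2 Y (d + 4)
  obtain ⟨D, hD, hbox⟩ := exists_lintegral_box_le hd hκ Y hY hR1
  refine ⟨C * B * D, fun r hr hr1 => ?_⟩
  set U := R / r ^ (d - 2) with hU
  set box : Set (Fin k → ℝ) := Set.univ.pi fun _ : Fin k => Set.Icc (-U) U with hbox_def
  have hbm : MeasurableSet box := MeasurableSet.univ_pi fun _ => measurableSet_Icc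
  have hpt : ∀ u : Fin k → ℝ,
      ‖higherF f β r (horoPoint r Y u) (r ^ (d - 2) • u) * w (r ^ (d - 2) • u)‖ₑ ≤
      box.indicator (fun u => ENNReal.ofReal (C * B) *
        (1 + ∏ j, ∏ i, shearSum (d + 4) r (Y j i) (u j))) u := by
    intro u
    by_cases hu : u ∈ box
    · rw [Set.indicator_of_mem hu, enorm_mul, ENNReal.ofReal_mul hC.le, mul_right_comm]
      refine mul_le_mul' (hF r hr hr1 u _) ?_
      rw [← ofReal_norm]
      exact ENNReal.ofReal_le_ofReal (hwb _)
    · rw [Set.indicator_of_notMem hu]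
      have h0 : w (r ^ (d - 2) • u) = 0 := by
        by_contra hne
        apply hu
        have h1 : r ^ (d - 2) • u ∈ Metric.closedBall (0 : Fin k → ℝ) R₀ :=
          hR₀ (subset_tsupport w hne)
        rw [mem_closedBall_zero_iff] at h1
        rw [hbox_def, Set.mem_univ_pi]
        intro j
        have h2 := (norm_le_pi_norm (r ^ (d - 2) • u) j).trans (h1.trans (le_max_left R₀ 1))
        rw [Pi.smul_apply, smul_eq_mul, norm_mul, Real.norm_of_nonneg (by positivity),
          Real.norm_eq_abs] at h2
        rw [Set.mem_Icc, ← abs_le, hU, le_div_iff₀' (by positivity)]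
        exact h2
      rw [h0, mul_zero, enorm_zero]
  have hint : ‖∫ u : Fin k → ℝ, higherF f β r (horoPoint r Y u) (r ^ (d - 2) • u) *
      w (r ^ (d - 2) • u)‖ₑ ≤ ENNReal.ofReal (C * B * (D / r ^ (k * (d - 2)))) := by
    refine (enorm_integral_le_lintegral_enorm _).trans ((lintegral_mono hpt).trans ?_)
    rw [lintegral_indicator hbm, lintegral_const_mul' _ _ ENNReal.ofReal_ne_top,
      ENNReal.ofReal_mul (p := C * B) (by positivity)]
    gcongr
    exact hbox r hr hr1
  rw [← ofReal_norm, ENNReal.ofReal_le_ofReal_iff (by positivity), Real.norm_eq_abs] at hint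
  rw [abs_mul, abs_of_pos (by positivity)]
  refine (mul_le_mul_of_nonneg_left hint (by positivity)).trans_eq ?_
  field_simp

/-- The product form of the condition on κ covers d = 2, where it reads 0 < 1. The upper limit is
taken in `EReal`, since a real `limsup` of an unbounded function would be a default value. -/
theorem mainTheorem5 (d k : ℕ) (hd : 2 ≤ d)
    (f : RMat d k → RMat d k → (Fin k → ℝ) → RVec d → ℝ → ℂ) (hf : IsSchwartzTilde f)
    (β : ℝ) (hβ0 : 0 < β) (hβ1 : β < 1)
    (κ : ℝ) (hκ : κ * ((d : ℝ) - 2) < (d : ℝ) - 1)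
    (Y : RMat d k) (hY : ∀ j, IsDiophantineVec κ (Y j)) (hYind : ∀ j, OneLinIndepRat (Y j))
    (w : (Fin k → ℝ) → ℝ) (hwm : AEMeasurable w) (hwb : ∃ B : ℝ, ∀ u, |w u| ≤ B)
    (hwc : HasCompactSupport w) :
    (∀ r : ℝ, 0 < r →
      (∀ u : Fin k → ℝ, HigherFConverges f β r (horoPoint r Y u) (r ^ (d - 2) • u)) ∧
      Integrable (fun u : Fin k → ℝ =>
        higherF f β r (horoPoint r Y u) (r ^ (d - 2) • u) * w (r ^ (d - 2) • u))) ∧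
    limsup (fun r : ℝ => ((|r ^ (k * (d - 2)) * ∫ u : Fin k → ℝ,
        higherF f β r (horoPoint r Y u) (r ^ (d - 2) • u) * w (r ^ (d - 2) • u)| : ℝ) : EReal))
      (𝓝[>] 0) < ⊤ := by
  obtain ⟨B, hB⟩ := hwb
  obtain ⟨S, hS1, hS2⟩ : ∃ S : ℕ, d + 1 ≤ S ∧ 2 ≤ (S : ℝ) * β := by
    -- Decay of order d+1 makes the integral over η converge; order 2/β makes the β-th power
    -- integrable in ω.
    refine ⟨max (d + 1) ⌈2 / β⌉₊, le_max_left _ _, ?_⟩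
    rw [← div_le_iff₀ hβ0]
    exact (Nat.le_ceil _).trans (by exact_mod_cast le_max_right _ _)
  have hw := integrable_of_bounded_hasCompactSupport hwm hB hwc
  refine ⟨fun r hr => ⟨fun u => hf.higherFConverges hβ0 hβ1 hS1 hS2 Y hr _ u,
    hf.integrable_higherF_mul hβ0 hβ1 hS1 hS2 Y hr (pow_pos hr _).ne' hw⟩, ?_⟩
  obtain ⟨C, hC⟩ := hf.exists_abs_mean_le hd hβ0 hβ1 hS1 hS2 hκ Y hY hB hwc
  refine lt_of_le_of_lt (limsup_le_of_le (a := ((C : ℝ) : EReal)) ?_ ?_) (EReal.coe_lt_top C)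
  · isBoundedDefault
  · have h1 : ∀ᶠ r : ℝ in 𝓝[>] 0, r ∈ Set.Ioc (0 : ℝ) 1 := Ioc_mem_nhdsGT one_pos
    filter_upwards [h1] with r hr
    exact EReal.coe_le_coe_iff.2 (hC r hr.1 hr.2)
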